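/- Let $n\ge 0$, let $A=(a_{ij})$ be a skew-symmetric $n\times n$ matrix with integer entries, and let $R=\mathbb{C}[X_1,\dots,X_n]$ be equipped with the Poisson bracket determined by $\{X_i,X_j\}=a_{ij}X_iX_j$. Let $M$ be the Poisson module over $R$ which is $R$ itself as an $R$-module, with the external bracket $\{\cdot,\cdot\}_M : M\times R\to M$ that is bilinear, satisfies $\{m,fg\}_M=f\{m,g\}_M+g\{m,f\}_M$, and is given by $$\{X^\alpha,X_i\}_M=-\sum_{j=1}^n a_{ij}(\alpha_j-1)\,X^{\alpha+\varepsilon_i}\qquad(\alpha\in\mathbb{N}^n,\ 1\le i\le n),$$ where $\varepsilon_i$ is the $i$-th unit vector. Let $\Omega^k(R)$ be the $R$-module of Kähler differential $k$-forms of $R$ over $\mathbb{C}$. The Poisson homology $HP_k(R,M)$ is the homology in degree $k$ of the complex of the spaces $M\otimes_R\Omega^k(R)$ with boundary $$\partial(m\otimes da_1\wedge\dots\wedge da_k)=\sum_{i}(-1)^{i+1}\{m,a_i\}_M\otimes da_1\wedge\dots\widehat{da_i}\dots\wedge da_k+\sum_{i<j}(-1)^{i+j}m\otimes d\{a_i,a_j\}\wedge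 da_1\wedge\dots\widehat{da_i}\dots\widehat{da_j}\dots\wedge da_k .$$ Let $\chi^k(R)$ be the space of alternating $\mathbb{C}$-multilinear maps $R^k\to R$ that are derivations in each argument. The Poisson cohomology $HP^k(R)$ is the cohomology in degree $k$ of the complex of the spaces $\chi^k(R)$ with coboundary $$\delta(P)(f_0,\dots,f_k)=\sum_{i}(-1)^i\{f_i,P(f_0,\dots,\widehat{f_i},\dots,f_k)\}+\sum_{i<j}(-1)^{i+j}P(\{f_i,f_j\},f_0,\dots,\widehat{f_i},\dots,\widehat{f_j},\dots,f_k).$$ Then for every $k\in\mathbb{N}$ there is an isomorphism of complex vector spaces $$HP_k(R,M)\cong HP^{n-k}(R),$$ where the right-hand side is $0$ for $k>n$. Moreover, for $0\le k\le n$ let $S_{k,n-k}$ be the set of permutations $\sigma$ of $\{1,\dots,n\}$ with $\sigma_1<\dots<\sigma_k$ and $\sigma_{k+1}<\dots<\sigma_n$, let $\varepsilon(\sigma)$ be the sign of $\sigma$, and define $\dagger:\chi^k(R)\to M\otimes_R\Omega^{n-k}(R)$ by $$\dagger(P)=\sum_{\sigma\in S_{k,n-k}}\varepsilon(\sigma)\,P(X_{\sigma_1},\dots,X_{\sigma_k})\otimes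 dX_{\sigma_{k+1}}\wedge\dots\wedge dX_{\sigma_n}.$$ Then $\dagger$ is an isomorphism of complex vector spaces for every $0\le k\le n$, and $$\dagger(\delta(P))=(-1)^{k+1}\,\partial(\dagger(P))\qquad\text{for all } P\in\chi^k(R),\ 0\le k<n .$$ -/

import Mathlib

open scoped TensorProduct

noncomputable section

namespace PoissonDuality

/-- A Poisson bracket on a commutative `ℂ`-algebra: a Lie bracket which is a derivation in each
argument. -/
structure PoissonBracket (R : Type*) [CommRing R] [Algebra ℂ R] where
  br : R →ₗ[ℂ] R →ₗ[ℂ] R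
  br_self : ∀ a, br a a = 0
  jacobi : ∀ a b c, br a (br b c) + br b (br c a) + br c (br a b) = 0
  leibniz : ∀ a b c, br a (b * c) = b * br a c + c * br a b

/-- A (right) Poisson module over a Poisson algebra `(R, π)`; `br x a` is the external bracket
`{x, a}_M` and `a • x` is the (right) action `x.a` of the commutative algebra `R`. -/
structure PoissonModule {R : Type*} [CommRing R] [Algebra ℂ R] (π : PoissonBracket R)
    (M : Type*) [AddCommGroup M] [Module R M] [Module ℂ M] where
  br : M →ₗ[ℂ] R →ₗ[ℂ] M
  lie : ∀ x a b, br x (π.br a b) = br (br x a) b - br (br x b) a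
  smul_br : ∀ x a b, π.br a b • x = b • br x a - br (b • x) a
  br_mul : ∀ x a b, br x (a * b) = b • br x a + a • br x b

section General

variable {R : Type*} [CommRing R] [Algebra ℂ R]

lemma PoissonBracket.skew (π : PoissonBracket R) (a b : R) : π.br a b = - π.br b a := by
  have h := π.br_self (a + b)
  simp only [map_add, LinearMap.add_apply, π.br_self, zero_add, add_zero] at h
  exact eq_neg_of_add_eq_zero_right h

lemma PoissonBracket.leibniz_left (π : PoissonBracket R) (a b c : R) :
    π.br (a * b) c = a * π.br b c + b * π.br a c := by
  rw [π.skew, π.leibniz, π.skew c a, π.skew c b]; ring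

/-- The sum
`∑_{i < j} (-1)^{i+j} F({f_i, f_j}, f_0, …, f̂_i, …, f̂_j, …, f_k)` over `0 ≤ i < j ≤ k`.
It is empty if `k = 0`; for larger `k` the pairs `i < j` are encoded as
`(i.castSucc, j.succ)` with `i ≤ j`, so that `(-1)^{i+j}` becomes `(-1)^{i+j+1}`. -/
def pairSum (π : PoissonBracket R) {A : Type*} [AddCommGroup A] :
    (k : ℕ) → ((Fin k → R) → A) → (Fin (k + 1) → R) → A
  | 0, _, _ => 0
  | k + 1, F, f => ∑ i : Fin (k + 1), ∑ j ∈ Finset.Ici i, (-1 : ℤ) ^ (i + j + 1 : ℕ) •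
      F (Matrix.vecCons (π.br (f i.castSucc) (f j.succ))
        (j.removeNth (i.castSucc.removeNth f)))

variable {A : Type*} [AddCommGroup A] [Module ℂ A]

lemma exists_pairSum (π : PoissonBracket R) (k : ℕ) (F : R [⋀^Fin k]→ₗ[ℂ] A) :
    ∃ G : R [⋀^Fin (k + 1)]→ₗ[ℂ] A, ∀ f, G f = pairSum π k F f := by
  cases k with
  | zero => exact ⟨0, fun f => rfl⟩
  | succ k =>
    let g : R →ₗ[ℂ] R →ₗ[ℂ] R [⋀^Fin k]→ₗ[ℂ] A := π.br.compr₂ F.curryLeft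
    refine ⟨-(1 / 2 : ℂ) • AlternatingMap.alternatizeUncurryFin
      (AlternatingMap.alternatizeUncurryFinLM ∘ₗ g), fun f => ?_⟩
    rw [AlternatingMap.smul_apply,
      AlternatingMap.alternatizeUncurryFin_alternatizeUncurryFinLM_comp_apply, pairSum,
      Finset.smul_sum]
    refine Finset.sum_congr rfl fun i _ => ?_
    rw [Finset.smul_sum]
    refine Finset.sum_congr rfl fun j _ => ?_
    have h : g (f j.succ) (f i.castSucc) = - g (f i.castSucc) (f j.succ) := by
      simp only [g, LinearMap.compr₂_apply]
      rw [π.skew, map_neg]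
    rw [h, AlternatingMap.neg_apply, sub_neg_eq_add, ← two_smul ℂ, smul_comm, smul_smul]
    simp only [g, LinearMap.compr₂_apply, AlternatingMap.curryLeft_apply_apply]
    rw [pow_succ, mul_neg_one, neg_smul]
    norm_num

/-- The alternating map
`f ↦ ∑_i (-1)^i g(f_i)(f_0, …, f̂_i, …, f_k)
  + ∑_{i<j} (-1)^{i+j} F({f_i, f_j}, f_0, …, f̂_i, …, f̂_j, …, f_k)`. -/
def ceSum (π : PoissonBracket R) {k : ℕ} (g : R →ₗ[ℂ] R [⋀^Fin k]→ₗ[ℂ] A)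
    (F : R [⋀^Fin k]→ₗ[ℂ] A) : R [⋀^Fin (k + 1)]→ₗ[ℂ] A where
  toFun f := ∑ i : Fin (k + 1), (-1 : ℤ) ^ (i : ℕ) • g (f i) (i.removeNth f) + pairSum π k F f
  map_update_add' f i x y := by
    obtain ⟨G, hG⟩ := exists_pairSum π k F
    simp only [← hG, ← AlternatingMap.alternatizeUncurryFin_apply]
    rw [AlternatingMap.map_update_add, AlternatingMap.map_update_add]
    abel
  map_update_smul' f i c x := by
    obtain ⟨G, hG⟩ := exists_pairSum π k F
    simp only [← hG, ← AlternatingMap.alternatizeUncurryFin_apply]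
    rw [AlternatingMap.map_update_smul, AlternatingMap.map_update_smul, smul_add]
  map_eq_zero_of_eq' f i j hf hij := by
    obtain ⟨G, hG⟩ := exists_pairSum π k F
    simp only [← hG, ← AlternatingMap.alternatizeUncurryFin_apply]
    rw [AlternatingMap.map_eq_zero_of_eq _ f hf hij, AlternatingMap.map_eq_zero_of_eq _ f hf hij,
      add_zero]

lemma ceSum_apply (π : PoissonBracket R) {k : ℕ} (g : R →ₗ[ℂ] R [⋀^Fin k]→ₗ[ℂ] A)
    (F : R [⋀^Fin k]→ₗ[ℂ] A) (f : Fin (k + 1) → R) :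
    ceSum π g F f =
      ∑ i : Fin (k + 1), (-1 : ℤ) ^ (i : ℕ) • g (f i) (i.removeNth f) + pairSum π k F f := rfl

lemma map_cons_swap {k : ℕ} (F : R [⋀^Fin (k + 2)]→ₗ[ℂ] A) (x y : R) (w : Fin k → R) :
    F (Matrix.vecCons x (Matrix.vecCons y w)) = - F (Matrix.vecCons y (Matrix.vecCons x w)) := by
  rw [← F.map_swap _ (show (0 : Fin (k + 2)) ≠ 1 by simp)]
  congr 1
  ext i
  refine Fin.cases ?_ (fun i => Fin.cases ?_ (fun i => ?_) i) i
  · simp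
  · simp
  · have h0 : (i.succ.succ : Fin (k + 2)) ≠ 0 := Fin.succ_ne_zero _
    have h1 : (i.succ.succ : Fin (k + 2)) ≠ 1 := by
      rw [← Fin.succ_zero_eq_one]; exact fun h => Fin.succ_ne_zero _ (Fin.succ_injective _ h)
    simp [Equiv.swap_apply_of_ne_of_ne h0 h1]

lemma removeNth_succ_cons {R : Type*} {k : ℕ} (j : Fin (k + 1)) (x : R) (v : Fin (k + 1) → R) :
    j.succ.removeNth (Matrix.vecCons x v : Fin (k + 2) → R) =
      Matrix.vecCons x (j.removeNth v) := by
  ext i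
  refine Fin.cases ?_ (fun i => ?_) i <;> simp [Fin.removeNth]

lemma removeNth_zero_cons {R : Type*} {k : ℕ} (x : R) (v : Fin k → R) :
    (0 : Fin (k + 1)).removeNth (Matrix.vecCons x v : Fin (k + 1) → R) = v := by
  ext i; simp [Fin.removeNth]

lemma ceSum_cons (π : PoissonBracket R) {k : ℕ} (g : R →ₗ[ℂ] R [⋀^Fin (k + 1)]→ₗ[ℂ] A)
    (F : R [⋀^Fin (k + 1)]→ₗ[ℂ] A) (x : R) (v : Fin (k + 1) → R) :
    ceSum π g F (Matrix.vecCons x v) = g x v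
      - ∑ i : Fin (k + 1), (-1 : ℤ) ^ (i : ℕ) • (g (v i) (Matrix.vecCons x (i.removeNth v))
          + F (Matrix.vecCons (π.br x (v i)) (i.removeNth v)))
      + pairSum π k (fun w => - F (Matrix.vecCons x w)) v := by
  have h0 : (Finset.Ici (0 : Fin (k + 1))) = Finset.univ := by ext; simp
  have key : (∑ i : Fin k, ∑ j ∈ Finset.Ici i.succ, (-1 : ℤ) ^ (i.succ + j + 1 : ℕ) •
      F (Matrix.vecCons (π.br ((Matrix.vecCons x v : Fin (k + 2) → R) i.succ.castSucc) (v j))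
        (j.removeNth (i.succ.castSucc.removeNth (Matrix.vecCons x v : Fin (k + 2) → R))))) =
      pairSum π k (fun w => - F (Matrix.vecCons x w)) v := by
    cases k with
    | zero => simp [pairSum]
    | succ k =>
      rw [pairSum]
      refine Finset.sum_congr rfl fun i _ => ?_
      rw [show Finset.Ici i.succ = (Finset.Ici i).map (Fin.succEmb _) from by
        ext j
        refine Fin.cases ?_ (fun j => ?_) j <;> simp]
      rw [Finset.sum_map]
      refine Finset.sum_congr rfl fun j _ => ?_
      simp only [Fin.coe_succEmb, ← Fin.succ_castSucc, removeNth_succ_cons, Matrix.cons_val_succ]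
      rw [map_cons_swap, Fin.val_succ, Fin.val_succ]
      congr 1
      ring
  have e1 : ∑ i : Fin (k + 2), (-1 : ℤ) ^ (i : ℕ) • g ((Matrix.vecCons x v : Fin (k + 2) → R) i)
        (i.removeNth (Matrix.vecCons x v : Fin (k + 2) → R)) =
      g x v - ∑ i : Fin (k + 1), (-1 : ℤ) ^ (i : ℕ) •
        g (v i) (Matrix.vecCons x (i.removeNth v)) := by
    rw [Fin.sum_univ_succ]
    simp only [removeNth_succ_cons, removeNth_zero_cons, Matrix.cons_val_zero,
      Matrix.cons_val_succ, Fin.val_zero, Fin.val_succ, pow_zero, one_smul, pow_succ, mul_neg_one,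
      neg_smul, Finset.sum_neg_distrib, sub_eq_add_neg]
  have e2 : pairSum π (k + 1) F (Matrix.vecCons x v) =
      - ∑ i : Fin (k + 1), (-1 : ℤ) ^ (i : ℕ) •
        F (Matrix.vecCons (π.br x (v i)) (i.removeNth v))
      + pairSum π k (fun w => - F (Matrix.vecCons x w)) v := by
    rw [pairSum, Fin.sum_univ_succ, h0]
    simp only [Matrix.cons_val_succ] at key ⊢
    rw [key]
    congr 1
    rw [← Finset.sum_neg_distrib]
    refine Finset.sum_congr rfl fun i _ => ?_
    simp only [Fin.castSucc_zero, removeNth_zero_cons, Matrix.cons_val_zero, Fin.val_zero,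
      zero_add, pow_succ, mul_neg_one, neg_smul]
  rw [ceSum_apply, e1, e2]
  simp only [smul_add, Finset.sum_add_distrib]
  abel

lemma pairSum_add {A : Type*} [AddCommGroup A] (π : PoissonBracket R) (k : ℕ) (F₁ F₂ : (Fin k → R) → A) (f) :
    pairSum π k (fun w => F₁ w + F₂ w) f = pairSum π k F₁ f + pairSum π k F₂ f := by
  cases k with
  | zero => simp [pairSum]
  | succ k => simp [pairSum, smul_add, Finset.sum_add_distrib]

/-- A common Leibniz rule for `ceSum` in the first argument. -/
lemma ceSum_leibniz (π : PoissonBracket R) {k : ℕ}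
    (g g₁ g₂ : R →ₗ[ℂ] R [⋀^Fin k]→ₗ[ℂ] A) (F F₁ F₂ : R [⋀^Fin k]→ₗ[ℂ] A) (b c : R)
    (h1 : ∀ (i : Fin k) (w : Fin k → R), F (Function.update w i (b * c)) =
      F₁ (Function.update w i c) + F₂ (Function.update w i b))
    (h2 : ∀ (i : Fin k) (w : Fin k → R) (x : R),
      g x (Function.update w i (b * c)) + F (Function.update w i (π.br (b * c) x)) =
      (g₁ x (Function.update w i c) + F₁ (Function.update w i (π.br c x))) +
      (g₂ x (Function.update w i b) + F₂ (Function.update w i (π.br b x))))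
    (h3 : ∀ w, g (b * c) w = g₁ c w + g₂ b w) (v : Fin k → R) :
    ceSum π g F (Matrix.vecCons (b * c) v) =
      ceSum π g₁ F₁ (Matrix.vecCons c v) + ceSum π g₂ F₂ (Matrix.vecCons b v) := by
  cases k with
  | zero => simp [ceSum_apply, pairSum, h3]
  | succ k =>
    have hup : ∀ (w : Fin k → R) (y : R), Matrix.vecCons y w =
        Function.update (Matrix.vecCons 0 w : Fin (k + 1) → R) 0 y := by
      intro w y
      ext i
      refine Fin.cases ?_ (fun i => ?_) i <;> simp
    have h1' : ∀ w : Fin k → R, F (Matrix.vecCons (b * c) w) =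
        F₁ (Matrix.vecCons c w) + F₂ (Matrix.vecCons b w) := fun w => by
      rw [hup w (b * c), hup w c, hup w b, h1]
    have h2' : ∀ (w : Fin k → R) (x : R),
        g x (Matrix.vecCons (b * c) w) + F (Matrix.vecCons (π.br (b * c) x) w) =
        (g₁ x (Matrix.vecCons c w) + F₁ (Matrix.vecCons (π.br c x) w)) +
        (g₂ x (Matrix.vecCons b w) + F₂ (Matrix.vecCons (π.br b x) w)) := fun w x => by
      simp only [hup w (b * c), hup w c, hup w b, hup w (π.br _ x), h2]
    simp only [ceSum_cons, h1', h2', h3, neg_add, smul_add, Finset.sum_add_distrib, pairSum_add]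
    abel

/-- The subspace of the alternating `ℂ`-multilinear maps `R^k → R` which are derivations in each
of their arguments. -/
def multiDer (R : Type*) [CommRing R] [Algebra ℂ R] (k : ℕ) : Submodule ℂ (R [⋀^Fin k]→ₗ[ℂ] R) where
  carrier := {P | ∀ (i : Fin k) (f : Fin k → R) (a b : R), P (Function.update f i (a * b)) =
    a * P (Function.update f i b) + b * P (Function.update f i a)}
  add_mem' {P Q} hP hQ i f a b := by
    simp only [AlternatingMap.add_apply, hP i f a b, hQ i f a b]; ring
  zero_mem' i f a b := by simp
  smul_mem' c P hP i f a b := by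
    simp only [AlternatingMap.smul_apply, hP i f a b, smul_add, mul_smul_comm]

lemma update_eq_of_cons {k : ℕ} (P : R [⋀^Fin (k + 1)]→ₗ[ℂ] A) (i : Fin (k + 1))
    (f : Fin (k + 1) → R) (x : R) :
    P (Function.update f i x) = (-1 : ℤ) ^ (i : ℕ) • P (Matrix.vecCons x (i.removeNth f)) := by
  rw [← Fin.insertNth_removeNth, AlternatingMap.map_insertNth]

/-- The Hamiltonian term `a ↦ {a, P(·)}`. -/
def hamTerm (π : PoissonBracket R) {k : ℕ} (P : R [⋀^Fin k]→ₗ[ℂ] R) :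
    R →ₗ[ℂ] R [⋀^Fin k]→ₗ[ℂ] R where
  toFun a := (π.br a).compAlternatingMap P
  map_add' a b := by ext; simp
  map_smul' c a := by ext; simp

lemma hamTerm_apply (π : PoissonBracket R) {k : ℕ} (P : R [⋀^Fin k]→ₗ[ℂ] R) (a : R) (f) :
    hamTerm π P a f = π.br a (P f) := rfl

lemma coboundary_mem (π : PoissonBracket R) {k : ℕ} (P : multiDer R k) :
    ceSum π (hamTerm π P.1) P.1 ∈ multiDer R (k + 1) := by
  intro i f b c
  have hP := P.2
  have key := ceSum_leibniz π (hamTerm π P.1) (b • hamTerm π P.1) (c • hamTerm π P.1)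
    P.1 (b • P.1) (c • P.1) b c (fun i w => hP i w b c)
    (fun i w x => by
      simp only [LinearMap.smul_apply, AlternatingMap.smul_apply, hamTerm_apply, smul_eq_mul]
      rw [hP i w b c, π.leibniz_left b c x, P.1.map_update_add, hP, hP, map_add, π.leibniz,
        π.leibniz, π.skew x b, π.skew x c]
      ring)
    (fun w => by
      simp only [LinearMap.smul_apply, AlternatingMap.smul_apply, hamTerm_apply, smul_eq_mul,
        π.leibniz_left])
    (i.removeNth f)
  have hsm : ∀ (r : R) v, ceSum π (r • hamTerm π P.1) (r • P.1) v =
      r * ceSum π (hamTerm π P.1) P.1 v := by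
    intro r v
    have : ∀ k (F : (Fin k → R) → R) v, pairSum π k (fun w => r * F w) v = r * pairSum π k F v := by
      intro k F v
      cases k <;> simp only [pairSum, Finset.mul_sum, mul_smul_comm, mul_zero]
    simp only [ceSum_apply, mul_add, Finset.mul_sum, mul_smul_comm, ← this]
    rfl
  rw [hsm, hsm] at key
  simp only [update_eq_of_cons, key, smul_add, mul_smul_comm]

/-- The space `χ^k(R)` of skew-symmetric `k`-linear derivations of `R`. -/
def Chi (R : Type*) [CommRing R] [Algebra ℂ R] (k : ℕ) : Type _ := multiDer R k

instance (R : Type*) [CommRing R] [Algebra ℂ R] (k : ℕ) : AddCommGroup (Chi R k) :=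
  (multiDer R k).addCommGroup

instance (R : Type*) [CommRing R] [Algebra ℂ R] (k : ℕ) : Module ℂ (Chi R k) :=
  (multiDer R k).module

lemma Chi.val_add {k : ℕ} (P Q : Chi R k) : (P + Q).1 = P.1 + Q.1 := rfl

lemma Chi.val_smul {k : ℕ} (c : ℂ) (P : Chi R k) : (c • P).1 = c • P.1 := rfl

lemma Chi.ext' {k : ℕ} {P Q : Chi R k} (h : ∀ f, P.1 f = Q.1 f) : P = Q :=
  Subtype.ext (AlternatingMap.ext h)

/-- The Poisson coboundary operator `δ_k : χ^k(R) → χ^{k+1}(R)`. -/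
def coboundary (π : PoissonBracket R) (k : ℕ) : Chi R k →ₗ[ℂ] Chi R (k + 1) where
  toFun P := ⟨ceSum π (hamTerm π P.1) P.1, coboundary_mem π P⟩
  map_add' P Q := by
    refine Chi.ext' fun f => ?_
    change ceSum π (hamTerm π (P.1 + Q.1)) (P.1 + Q.1) f =
      ceSum π (hamTerm π P.1) P.1 f + ceSum π (hamTerm π Q.1) Q.1 f
    simp only [ceSum_apply, AlternatingMap.add_apply, hamTerm_apply, map_add,
      smul_add, Finset.sum_add_distrib]
    rw [show (⇑(P.1 + Q.1)) = fun w => P.1 w + Q.1 w from rfl, pairSum_add]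
    abel
  map_smul' c P := by
    have : ∀ k (F : (Fin k → R) → R) v, pairSum π k (fun w => c • F w) v = c • pairSum π k F v := by
      intro k F v
      cases k <;> simp [pairSum, Finset.smul_sum]
    refine Chi.ext' fun f => ?_
    change ceSum π (hamTerm π (c • P.1)) (c • P.1) f = c • ceSum π (hamTerm π P.1) P.1 f
    simp only [ceSum_apply, AlternatingMap.smul_apply, hamTerm_apply, map_smul,
      smul_add, Finset.smul_sum, ← this, smul_comm c]
    rfl

/-- The coboundary formula: `δ(P)(f_0, …, f_k)` is
`∑_i (-1)^i {f_i, P(f_0, …, f̂_i, …, f_k)}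
  + ∑_{i<j} (-1)^{i+j} P({f_i, f_j}, f_0, …, f̂_i, …, f̂_j, …, f_k)`. -/
theorem coboundary_apply (π : PoissonBracket R) (k : ℕ) (P : Chi R k) (f : Fin (k + 1) → R) :
    (coboundary π k P).1 f =
      ∑ i : Fin (k + 1), (-1 : ℤ) ^ (i : ℕ) • π.br (f i) (P.1 (i.removeNth f))
        + pairSum π k P.1 f := rfl

/-- The exterior product `(a_1, …, a_k) ↦ da_1 ∧ ⋯ ∧ da_k` in the module
`Ω^k(R) = ⋀^k_R Ω_{R/ℂ}` of Kähler differential `k`-forms. -/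
def wedgeD (R : Type*) [CommRing R] [Algebra ℂ R] (k : ℕ) :
    R [⋀^Fin k]→ₗ[ℂ] ⋀[R]^k (Ω[R⁄ℂ]) where
  toFun a := exteriorPower.ιMulti R k fun i => KaehlerDifferential.D ℂ R (a i)
  map_update_add' {inst} a i x y := by
    obtain rfl : inst = instDecidableEqFin k := Subsingleton.elim _ _
    have h : ∀ z, (fun j => KaehlerDifferential.D ℂ R (Function.update a i z j)) =
        Function.update (fun j => KaehlerDifferential.D ℂ R (a j)) i
          (KaehlerDifferential.D ℂ R z) := fun z => by
      ext1 j; exact Function.apply_update (fun _ => KaehlerDifferential.D ℂ R) a i z j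
    rw [h, h, h, map_add, AlternatingMap.map_update_add]
  map_update_smul' {inst} a i c x := by
    obtain rfl : inst = instDecidableEqFin k := Subsingleton.elim _ _
    have h : ∀ z, (fun j => KaehlerDifferential.D ℂ R (Function.update a i z j)) =
        Function.update (fun j => KaehlerDifferential.D ℂ R (a j)) i
          (KaehlerDifferential.D ℂ R z) := fun z => by
      ext1 j; exact Function.apply_update (fun _ => KaehlerDifferential.D ℂ R) a i z j
    rw [h, h, Derivation.map_smul, ← algebraMap_smul R c (KaehlerDifferential.D ℂ R x),
      AlternatingMap.map_update_smul, algebraMap_smul]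
  map_eq_zero_of_eq' a i j h hij :=
    AlternatingMap.map_eq_zero_of_eq _ _ (congrArg (KaehlerDifferential.D ℂ R) h) hij

lemma wedgeD_mul {k : ℕ} (i : Fin k) (w : Fin k → R) (b c : R) :
    wedgeD R k (Function.update w i (b * c)) =
      b • wedgeD R k (Function.update w i c) + c • wedgeD R k (Function.update w i b) := by
  have h : ∀ z, (fun j => KaehlerDifferential.D ℂ R (Function.update w i z j)) =
      Function.update (fun j => KaehlerDifferential.D ℂ R (w j)) i
        (KaehlerDifferential.D ℂ R z) := fun z => by
    ext1 j; exact Function.apply_update (fun _ => KaehlerDifferential.D ℂ R) w i z j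
  simp only [wedgeD, AlternatingMap.coe_mk, MultilinearMap.coe_mk, h, Derivation.leibniz,
    AlternatingMap.map_update_add, AlternatingMap.map_update_smul]

variable {M : Type*} [AddCommGroup M] [Module R M] [Module ℂ M] [IsScalarTower ℂ R M]

/-- The space `C_k(R, M) = M ⊗_R Ω^k(R)` of `k`-chains. -/
abbrev Chains (R : Type*) [CommRing R] [Algebra ℂ R] (M : Type*) [AddCommGroup M] [Module R M]
    (k : ℕ) : Type _ :=
  M ⊗[R] ⋀[R]^k (Ω[R⁄ℂ])

/-- `(a_1, …, a_k) ↦ m ⊗ da_1 ∧ ⋯ ∧ da_k`. -/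
def chainAlt (R : Type*) [CommRing R] [Algebra ℂ R] {M : Type*} [AddCommGroup M] [Module R M]
    [Module ℂ M] [IsScalarTower ℂ R M] (k : ℕ) : M →ₗ[ℂ] R [⋀^Fin k]→ₗ[ℂ] Chains R M k where
  toFun m := ((TensorProduct.mk R M (⋀[R]^k (Ω[R⁄ℂ])) m).restrictScalars ℂ).compAlternatingMap
    (wedgeD R k)
  map_add' x y := by ext; simp
  map_smul' c x := by ext; simp [TensorProduct.smul_tmul']

@[simp]
lemma chainAlt_apply (k : ℕ) (m : M) (a : Fin k → R) :
    chainAlt R k m a = m ⊗ₜ[R] wedgeD R k a := rfl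

/-- The right-hand side of the boundary formula, as an alternating `ℂ`-multilinear map in
`(a_1, …, a_{k+1})`. -/
def boundaryAlt {π : PoissonBracket R} (μ : PoissonModule π M) (k : ℕ) :
    M →ₗ[ℂ] R [⋀^Fin (k + 1)]→ₗ[ℂ] Chains R M k where
  toFun m := ceSum π ((chainAlt R k).comp (μ.br m)) (chainAlt R k m)
  map_add' x y := by
    ext f
    simp only [ceSum_apply, map_add, LinearMap.comp_add, LinearMap.add_apply,
      AlternatingMap.add_apply, smul_add, Finset.sum_add_distrib]
    rw [show ⇑(chainAlt R k x + chainAlt R k y) =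
      fun w => chainAlt R k x w + chainAlt R k y w from rfl, pairSum_add]
    abel
  map_smul' c x := by
    have : ∀ k (F : (Fin k → R) → Chains R M k) v,
        pairSum π k (fun w => c • F w) v = c • pairSum π k F v := by
      intro k F v
      cases k <;> simp [pairSum, Finset.smul_sum, smul_comm c]
    ext f
    simp only [ceSum_apply, map_smul, LinearMap.comp_smul, LinearMap.smul_apply,
      AlternatingMap.smul_apply, smul_add, Finset.smul_sum, RingHom.id_apply, ← this, smul_comm c]
    rfl

lemma boundaryAlt_apply {π : PoissonBracket R} (μ : PoissonModule π M) (k : ℕ) (m : M)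
    (a : Fin (k + 1) → R) :
    boundaryAlt μ k m a =
      ∑ i : Fin (k + 1), (-1 : ℤ) ^ (i : ℕ) • (μ.br m (a i) ⊗ₜ[R] wedgeD R k (i.removeNth a))
        + pairSum π k (fun b => m ⊗ₜ[R] wedgeD R k b) a := rfl

lemma boundaryAlt_mul {π : PoissonBracket R} (μ : PoissonModule π M) (k : ℕ) (m : M)
    (i : Fin (k + 1)) (a : Fin (k + 1) → R) (b c : R) :
    boundaryAlt μ k m (Function.update a i (b * c)) =
      boundaryAlt μ k (b • m) (Function.update a i c) +
      boundaryAlt μ k (c • m) (Function.update a i b) := by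
  have key := ceSum_leibniz π ((chainAlt R k).comp (μ.br m)) ((chainAlt R k).comp (μ.br (b • m)))
    ((chainAlt R k).comp (μ.br (c • m))) (chainAlt R k m) (chainAlt R k (b • m))
    (chainAlt R k (c • m)) b c
    (fun i w => by
      simp only [chainAlt_apply, wedgeD_mul, TensorProduct.tmul_add, TensorProduct.tmul_smul,
        TensorProduct.smul_tmul'])
    (fun i w x => by
      have e : ∀ y, μ.br (y • m) x = y • μ.br m x + π.br y x • m := fun y => by
        rw [π.skew, neg_smul, μ.smul_br]; abel
      simp only [LinearMap.comp_apply, chainAlt_apply, wedgeD_mul, π.leibniz_left b c x,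
        AlternatingMap.map_update_add, TensorProduct.tmul_add, TensorProduct.tmul_smul,
        TensorProduct.smul_tmul', e, TensorProduct.add_tmul]
      abel)
    (fun w => by
      have e : ∀ y z, μ.br (y • m) z = y • μ.br m z + π.br y z • m := fun y z => by
        rw [π.skew, neg_smul, μ.smul_br]; abel
      simp only [LinearMap.comp_apply, chainAlt_apply, ← TensorProduct.add_tmul, e, μ.br_mul]
      rw [π.skew c b]
      congr 1
      simp only [neg_smul]
      abel)
    (i.removeNth a)
  simp only [update_eq_of_cons]
  rw [← smul_add]
  exact congrArg _ key

end General

section Polynomial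

open MvPolynomial Set.powersetCard

/-- The polynomial algebra `ℂ[X_1, …, X_n]`. -/
abbrev Poly (n : ℕ) : Type := MvPolynomial (Fin n) ℂ

variable {n : ℕ} {M : Type*} [AddCommGroup M] [Module (Poly n) M] [Module ℂ M]

lemma eq_zero_of_leibniz {N : Type*} [AddCommGroup N] [Module ℂ N] {k : ℕ}
    (T : M →ₗ[ℂ] Poly n [⋀^Fin k]→ₗ[ℂ] N)
    (hT : ∀ m i a b c, T m (Function.update a i (b * c)) =
      T (b • m) (Function.update a i c) + T (c • m) (Function.update a i b))
    (hX : ∀ m (v : Fin k → Fin n), T m (fun i => X (v i)) = 0) (m : M) (a : Fin k → Poly n) :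
    T m a = 0 := by
  suffices H : ∀ (S : Finset (Fin k)) (a : Fin k → Poly n), (∀ i ∉ S, ∃ j, a i = X j) →
      ∀ m, T m a = 0 from H Finset.univ a (fun i hi => absurd (Finset.mem_univ i) hi) m
  intro S
  induction S using Finset.induction_on with
  | empty =>
    intro a ha m
    choose v hv using fun i => ha i (Finset.notMem_empty i)
    rw [show a = fun i => X (v i) from funext hv]
    exact hX m v
  | insert i S _ ih =>
    intro a ha m
    have hX' : ∀ j m, T m (Function.update a i (X j)) = 0 := fun j m => by
      refine ih _ (fun l hl => ?_) m
      by_cases hli : l = i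
      · subst hli; exact ⟨j, by simp⟩
      · rw [Function.update_of_ne hli]
        exact ha l (by simp [hli, hl])
    suffices H : ∀ p m, T m (Function.update a i p) = 0 by
      simpa using H (a i) m
    intro p
    induction p using MvPolynomial.induction_on with
    | C c =>
      intro m
      have h1 : T m (Function.update a i 1) = 0 := by
        have := hT m i a 1 1
        simpa using this
      rw [show (C c : Poly n) = c • 1 by rw [smul_eq_C_mul, mul_one],
        AlternatingMap.map_update_smul, h1, smul_zero]
    | add p q hp hq => intro m; rw [AlternatingMap.map_update_add, hp, hq, add_zero]
    | mul_X p j hp => intro m; rw [hT, hp, hX', add_zero]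

variable [IsScalarTower ℂ (Poly n) M]

/-- The basis `dX_{i_1} ∧ ⋯ ∧ dX_{i_k}`, `i_1 < ⋯ < i_k`, of `Ω^k(ℂ[X_1, …, X_n])`. -/
def formBasis (n k : ℕ) :
    Module.Basis (Set.powersetCard (Fin n) k) (Poly n) (⋀[Poly n]^k (Ω[Poly n⁄ℂ])) :=
  (KaehlerDifferential.mvPolynomialBasis ℂ (Fin n)).exteriorPower k

/-- The coefficient in `M` of a chain at `dX_{i_1} ∧ ⋯ ∧ dX_{i_k}`. -/
def chainCoeff (M : Type*) [AddCommGroup M] [Module (Poly n) M] {k : ℕ}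
    (s : Set.powersetCard (Fin n) k) : Chains (Poly n) M k →ₗ[Poly n] M :=
  (TensorProduct.rid (Poly n) M).toLinearMap ∘ₗ LinearMap.lTensor M ((formBasis n k).coord s)

/-- The Poisson boundary operator `∂ : C_{k+1}(R, M) → C_k(R, M)` for `R = ℂ[X_1, …, X_n]`. It is
defined from the values on the chains `m ⊗ dX_{i_1} ∧ ⋯ ∧ dX_{i_{k+1}}`; see `boundary_tmul` for
its values on all chains `m ⊗ da_1 ∧ ⋯ ∧ da_{k+1}`. -/
def boundary {π : PoissonBracket (Poly n)} (μ : PoissonModule π M) (k : ℕ) :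
    Chains (Poly n) M (k + 1) →ₗ[ℂ] Chains (Poly n) M k :=
  ∑ s : Set.powersetCard (Fin n) (k + 1),
    { toFun := fun x => boundaryAlt μ k (chainCoeff M s x) fun i => X (ofFinEmbEquiv.symm s i)
      map_add' := fun x y => by rw [map_add, map_add, AlternatingMap.add_apply]
      map_smul' := fun c x => by
        rw [LinearMap.map_smul_of_tower, map_smul, AlternatingMap.smul_apply, RingHom.id_apply] }

lemma boundary_apply {π : PoissonBracket (Poly n)} (μ : PoissonModule π M) (k : ℕ)
    (x : Chains (Poly n) M (k + 1)) :
    boundary μ k x = ∑ s : Set.powersetCard (Fin n) (k + 1),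
      boundaryAlt μ k (chainCoeff M s x) fun i => X (ofFinEmbEquiv.symm s i) := by
  simp [boundary]

/-- The boundary formula: `∂(m ⊗ da_1 ∧ ⋯ ∧ da_{k+1})` is
`∑_i (-1)^{i+1} {m, a_i}_M ⊗ da_1 ∧ ⋯ ∧ (omit da_i) ∧ ⋯ ∧ da_{k+1}
  + ∑_{i<j} (-1)^{i+j} m ⊗ d{a_i, a_j} ∧ da_1 ∧ ⋯ ∧ (omit da_i, da_j) ∧ ⋯ ∧ da_{k+1}`
(below the indices start from `0`). As these chains span, this determines `∂`. -/
theorem boundary_tmul {π : PoissonBracket (Poly n)} (μ : PoissonModule π M) (k : ℕ) (m : M)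
    (a : Fin (k + 1) → Poly n) :
    boundary μ k (m ⊗ₜ[Poly n] wedgeD (Poly n) (k + 1) a) =
      ∑ i : Fin (k + 1),
        (-1 : ℤ) ^ (i : ℕ) • (μ.br m (a i) ⊗ₜ[Poly n] wedgeD (Poly n) k (i.removeNth a))
      + pairSum π k (fun b => m ⊗ₜ[Poly n] wedgeD (Poly n) k b) a := by
  rw [← boundaryAlt_apply, ← chainAlt_apply, ← sub_eq_zero]
  let L : (Poly n [⋀^Fin (k + 1)]→ₗ[ℂ] Chains (Poly n) M (k + 1)) →ₗ[ℂ]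
      (Poly n [⋀^Fin (k + 1)]→ₗ[ℂ] Chains (Poly n) M k) :=
    { toFun := fun F => (boundary μ k).compAlternatingMap F
      map_add' := fun F G => by ext; simp
      map_smul' := fun c F => by ext; simp }
  let T : M →ₗ[ℂ] Poly n [⋀^Fin (k + 1)]→ₗ[ℂ] Chains (Poly n) M k :=
    L ∘ₗ chainAlt (Poly n) (k + 1) - boundaryAlt μ k
  have hTa : ∀ m a, T m a = boundary μ k (chainAlt (Poly n) (k + 1) m a) -
      boundaryAlt μ k m a := fun m a => rfl
  rw [← hTa]
  refine eq_zero_of_leibniz T (fun m i a b c => ?_) (fun m v => ?_) m a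
  · simp only [hTa, boundaryAlt_mul, chainAlt_apply, wedgeD_mul, TensorProduct.tmul_add,
      TensorProduct.tmul_smul, TensorProduct.smul_tmul', map_add]
    abel
  · by_cases hv : Function.Injective v
    · have hs : StrictMono (v ∘ Tuple.sort v) :=
        (Tuple.monotone_sort v).strictMono_of_injective (hv.comp (Tuple.sort v).injective)
      have hp := (T m).map_perm (fun i => X (v i)) (Tuple.sort v)
      suffices h0 : T m ((fun i => (X (v i) : Poly n)) ∘ Tuple.sort v) = 0 by
        rw [h0] at hp
        exact ((smul_eq_zero_iff_eq _).1 hp.symm)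
      set s : Set.powersetCard (Fin n) (k + 1) :=
        ofFinEmbEquiv (OrderEmbedding.ofStrictMono _ hs) with hsdef
      have hse : ∀ i, v (Tuple.sort v i) = ofFinEmbEquiv.symm s i := fun i => by
        rw [hsdef, Equiv.symm_apply_apply]; rfl
      have hfun : ((fun i => (X (v i) : Poly n)) ∘ Tuple.sort v) =
          fun i => X (ofFinEmbEquiv.symm s i) := by
        funext i; simp only [Function.comp_apply, hse]
      have hw : wedgeD (Poly n) (k + 1) (fun i => X (ofFinEmbEquiv.symm s i)) =
          formBasis n (k + 1) s := by
        rw [formBasis, exteriorPower.basis_apply, exteriorPower.ιMulti_family]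
        simp only [wedgeD, AlternatingMap.coe_mk, MultilinearMap.coe_mk]
        congr 1
        funext i
        simp
      rw [hfun, hTa, sub_eq_zero, boundary_apply, chainAlt_apply, hw]
      rw [Finset.sum_eq_single s]
      · simp [chainCoeff]
      · intro t _ hts
        have : chainCoeff M t (m ⊗ₜ[Poly n] formBasis n (k + 1) s) = 0 := by
          simp [chainCoeff, hts.symm]
        rw [this, map_zero, AlternatingMap.zero_apply]
      · simp
    · rw [Function.Injective] at hv
      push Not at hv
      obtain ⟨i, j, hij, hne⟩ := hv
      exact (T m).map_eq_zero_of_eq _ (by simp [hij]) hne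

/-- The space of Poisson `k`-cycles (every `0`-chain is a cycle). -/
def cycles {π : PoissonBracket (Poly n)} (μ : PoissonModule π M) :
    (k : ℕ) → Submodule ℂ (Chains (Poly n) M k)
  | 0 => ⊤
  | k + 1 => LinearMap.ker (boundary μ k)

/-- The Poisson homology `HP_k(R, M)`: cycles modulo boundaries. -/
abbrev PoissonHomology {π : PoissonBracket (Poly n)} (μ : PoissonModule π M) (k : ℕ) : Type _ :=
  cycles μ k ⧸ (LinearMap.range (boundary μ k)).comap (cycles μ k).subtype

/-- The space of Poisson `k`-coboundaries (it is zero for `k = 0`). -/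
def coboundaries {R : Type*} [CommRing R] [Algebra ℂ R] (π : PoissonBracket R) :
    (k : ℕ) → Submodule ℂ (Chi R k)
  | 0 => ⊥
  | k + 1 => LinearMap.range (coboundary π k)

/-- The Poisson cohomology `HP^k(R)`: cocycles modulo coboundaries. -/
abbrev PoissonCohomology {R : Type*} [CommRing R] [Algebra ℂ R] (π : PoissonBracket R) (k : ℕ) :
    Type _ :=
  LinearMap.ker (coboundary π k) ⧸
    (coboundaries π k).comap (LinearMap.ker (coboundary π k)).subtype

end Polynomial

section Quadratic

open MvPolynomial

variable {n : ℕ}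

/-- The bracket `{f, g} = ∑_{i,j} a_{ij} X_i X_j (∂f/∂X_i) (∂g/∂X_j)`. -/
def quadBr (A : Matrix (Fin n) (Fin n) ℤ) : Poly n →ₗ[ℂ] Poly n →ₗ[ℂ] Poly n :=
  LinearMap.mk₂ ℂ
    (fun f g => ∑ i, ∑ j, (A i j : Poly n) * X i * X j * pderiv i f * pderiv j g)
    (fun f f' g => by simp only [map_add, mul_add, add_mul, Finset.sum_add_distrib])
    (fun c f g => by
      simp only [Derivation.map_smul, mul_smul_comm, smul_mul_assoc, Finset.smul_sum])
    (fun f g g' => by simp only [map_add, mul_add, Finset.sum_add_distrib])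
    (fun c f g => by simp only [Derivation.map_smul, mul_smul_comm, Finset.smul_sum])

lemma quadBr_apply (A : Matrix (Fin n) (Fin n) ℤ) (f g : Poly n) :
    quadBr A f g = ∑ i, ∑ j, (A i j : Poly n) * X i * X j * pderiv i f * pderiv j g := rfl

lemma quadBr_leibniz (A : Matrix (Fin n) (Fin n) ℤ) (f g h : Poly n) :
    quadBr A f (g * h) = g * quadBr A f h + h * quadBr A f g := by
  simp only [quadBr_apply, Finset.mul_sum, ← Finset.sum_add_distrib]
  refine Finset.sum_congr rfl fun i _ => Finset.sum_congr rfl fun j _ => ?_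
  rw [Derivation.leibniz, smul_eq_mul, smul_eq_mul]; ring

/-- `{X_i, X_j} = a_{ij} X_i X_j`. -/
lemma quadBr_X (A : Matrix (Fin n) (Fin n) ℤ) (i j : Fin n) :
    quadBr A (X i) (X j) = (A i j : Poly n) * X i * X j := by
  rw [quadBr_apply, Finset.sum_eq_single i, Finset.sum_eq_single j]
  · simp
  · intro l _ hl; simp [pderiv_X, hl.symm]
  · simp
  · intro l _ hl; simp [pderiv_X, hl.symm]
  · simp

lemma quadBr_C (A : Matrix (Fin n) (Fin n) ℤ) (f : Poly n) (c : ℂ) : quadBr A f (C c) = 0 := by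
  simp [quadBr_apply]

lemma entry_skew {A : Matrix (Fin n) (Fin n) ℤ} (hA : A.transpose = -A) (i j : Fin n) :
    (A j i : Poly n) = -(A i j : Poly n) := by
  have := congrFun (congrFun hA i) j
  simp only [Matrix.transpose_apply, Matrix.neg_apply] at this
  rw [this]; push_cast; rfl

lemma quadBr_skew {A : Matrix (Fin n) (Fin n) ℤ} (hA : A.transpose = -A) (f g : Poly n) :
    quadBr A f g = - quadBr A g f := by
  rw [quadBr_apply, quadBr_apply, Finset.sum_comm, ← Finset.sum_neg_distrib]
  refine Finset.sum_congr rfl fun i _ => ?_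
  rw [← Finset.sum_neg_distrib]
  refine Finset.sum_congr rfl fun j _ => ?_
  rw [entry_skew hA i j]; ring

lemma quadBr_leibniz_left {A : Matrix (Fin n) (Fin n) ℤ} (hA : A.transpose = -A) (f g h : Poly n) :
    quadBr A (f * g) h = f * quadBr A g h + g * quadBr A f h := by
  rw [quadBr_skew hA, quadBr_leibniz, quadBr_skew hA h g, quadBr_skew hA h f]; ring

lemma quadBr_jacobi {A : Matrix (Fin n) (Fin n) ℤ} (hA : A.transpose = -A) (f g h : Poly n) :
    quadBr A f (quadBr A g h) + quadBr A g (quadBr A h f) + quadBr A h (quadBr A f g) = 0 := by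
  have red : ∀ f g : Poly n,
      (∀ l, quadBr A f (quadBr A g (X l)) + quadBr A g (quadBr A (X l) f) +
        quadBr A (X l) (quadBr A f g) = 0) →
      ∀ h, quadBr A f (quadBr A g h) + quadBr A g (quadBr A h f) + quadBr A h (quadBr A f g) = 0 := by
    intro f g hl h
    induction h using MvPolynomial.induction_on with
    | C c => simp [quadBr_C, quadBr_skew hA (C c)]
    | add p q hp hq =>
      simp only [map_add, LinearMap.add_apply]
      linear_combination hp + hq
    | mul_X p j hp =>
      have h1 := hl j
      simp only [quadBr_leibniz, quadBr_leibniz_left hA, map_add] at h1 ⊢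
      rw [quadBr_skew hA p f, quadBr_skew hA (X j) f, map_neg, map_neg] at *
      linear_combination p * h1 + X j * hp
  have cyc : ∀ f g h : Poly n,
      quadBr A f (quadBr A g h) + quadBr A g (quadBr A h f) + quadBr A h (quadBr A f g) = 0 →
      quadBr A g (quadBr A h f) + quadBr A h (quadBr A f g) + quadBr A f (quadBr A g h) = 0 := by
    intro f g h e; rw [← e]; ring
  refine red f g (fun l => ?_) h
  refine cyc _ _ _ (red (X l) f (fun m => ?_) g)
  refine cyc _ _ _ (red (X m) (X l) (fun i => ?_) f)
  have hc : ∀ (i j : Fin n) (p q : Poly n), quadBr A q ((A i j : Poly n) * p) =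
      (A i j : Poly n) * quadBr A q p := by
    intro i j p q
    rw [← zsmul_eq_mul, map_zsmul, zsmul_eq_mul]
  simp only [quadBr_X, mul_assoc, hc, quadBr_leibniz]
  rw [entry_skew hA m l, entry_skew hA m i, entry_skew hA l i]
  ring

/-- The Poisson bracket on `R = ℂ[X_1, …, X_n]` with `{X_i, X_j} = a_{ij} X_i X_j`, for a
skew-symmetric integer matrix `(a_{ij})`. -/
def quadBracket (A : Matrix (Fin n) (Fin n) ℤ) (hA : A.transpose = -A) :
    PoissonBracket (Poly n) where
  br := quadBr A
  br_self f := by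
    have h := quadBr_skew hA f f
    exact self_eq_neg.1 h
  jacobi := quadBr_jacobi hA
  leibniz := quadBr_leibniz A

/-- The linear map `m ↦ {m, X_i}_M` on `M = R`, given on monomials by
`{X^α, X_i}_M = -∑_j a_{ij} (α_j - 1) X^{α + ε_i}`. -/
def twistGen (A : Matrix (Fin n) (Fin n) ℤ) (i : Fin n) : Poly n →ₗ[ℂ] Poly n :=
  (basisMonomials (Fin n) ℂ).constr ℂ fun α =>
    monomial (α + Finsupp.single i 1) (-∑ j, (A i j : ℂ) * ((α j : ℂ) - 1))

lemma twistGen_monomial (A : Matrix (Fin n) (Fin n) ℤ) (i : Fin n) (α : Fin n →₀ ℕ) :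
    twistGen A i (monomial α 1) =
      monomial (α + Finsupp.single i 1) (-∑ j, (A i j : ℂ) * ((α j : ℂ) - 1)) := by
  have := (basisMonomials (Fin n) ℂ).constr_basis ℂ (fun α =>
    monomial (α + Finsupp.single i 1) (-∑ j, (A i j : ℂ) * ((α j : ℂ) - 1))) α
  rwa [coe_basisMonomials] at this

/-- The external bracket of `M = R`: the extension of `{m, X_i}_M` to a derivation in the second
argument, `{m, f}_M = ∑_i (∂f/∂X_i) {m, X_i}_M`. -/
def twistBr (A : Matrix (Fin n) (Fin n) ℤ) : Poly n →ₗ[ℂ] Poly n →ₗ[ℂ] Poly n :=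
  LinearMap.mk₂ ℂ (fun m f => ∑ i, pderiv i f * twistGen A i m)
    (fun m m' f => by simp only [map_add, mul_add, Finset.sum_add_distrib])
    (fun c m f => by simp only [map_smul, mul_smul_comm, Finset.smul_sum])
    (fun m f f' => by simp only [map_add, add_mul, Finset.sum_add_distrib])
    (fun c m f => by simp only [Derivation.map_smul, smul_mul_assoc, Finset.smul_sum])

/-- `{X^α, X_i}_M = -∑_j a_{ij} (α_j - 1) X^{α + ε_i}`. -/
theorem twistBr_monomial_X (A : Matrix (Fin n) (Fin n) ℤ) (i : Fin n) (α : Fin n →₀ ℕ) :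
    twistBr A (monomial α 1) (X i) =
      monomial (α + Finsupp.single i 1) (-∑ j, (A i j : ℂ) * ((α j : ℂ) - 1)) := by
  rw [← twistGen_monomial, twistBr, LinearMap.mk₂_apply, Finset.sum_eq_single i]
  · simp
  · intro l _ hl; simp [pderiv_X, hl.symm]
  · simp

/-- The derivation `X_i ↦ (∑_l a_{il}) X_i`. -/
def twistDer (A : Matrix (Fin n) (Fin n) ℤ) : Derivation ℂ (Poly n) (Poly n) :=
  mkDerivation ℂ fun i => (∑ l, (A i l : Poly n)) * X i

lemma twistGen_eq {A : Matrix (Fin n) (Fin n) ℤ} (hA : A.transpose = -A) (i : Fin n) (m : Poly n) :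
    twistGen A i m = quadBr A m (X i) + (∑ l, (A i l : Poly n)) * X i * m := by
  suffices H : twistGen A i = (quadBr A).flip (X i) +
      LinearMap.mulLeft ℂ ((∑ l, (A i l : Poly n)) * X i) from by
    rw [H]; simp [mul_assoc]
  refine (basisMonomials (Fin n) ℂ).ext fun α => ?_
  rw [coe_basisMonomials]
  simp only [LinearMap.add_apply, LinearMap.flip_apply, LinearMap.mulLeft_apply]
  rw [twistGen_monomial, quadBr_apply]
  have h1 : ∀ l, (∑ j, (A l j : Poly n) * X l * X j * pderiv l (monomial α (1 : ℂ)) *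
      pderiv j (X i)) = (A l i : Poly n) * X i * ((α l : Poly n) * monomial α 1) := by
    intro l
    rw [Finset.sum_eq_single i]
    · rw [pderiv_X_self, mul_one, ← nsmul_eq_mul (α l), ← X_mul_pderiv_monomial]
      ring
    · intro j _ hj; simp [pderiv_X, hj.symm]
    · simp
  simp only [h1]
  have h2 : (monomial (α + Finsupp.single i 1) (-∑ j, (A i j : ℂ) * ((α j : ℂ) - 1)) : Poly n) =
      C (-∑ j, (A i j : ℂ) * ((α j : ℂ) - 1)) * (X i * monomial α 1) := by
    rw [X, monomial_mul, C_mul_monomial, add_comm]; simp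
  rw [h2]
  simp only [map_neg, map_sum, map_mul, map_sub, map_intCast, map_natCast, map_one]
  simp only [Finset.sum_mul, ← Finset.sum_add_distrib, ← Finset.sum_neg_distrib]
  refine Finset.sum_congr rfl fun l _ => ?_
  rw [entry_skew hA i l]; ring

lemma twistBr_eq {A : Matrix (Fin n) (Fin n) ℤ} (hA : A.transpose = -A) (m f : Poly n) :
    twistBr A m f = quadBr A m f + twistDer A f * m := by
  have hL : ∀ p q, twistBr A m (p * q) = p * twistBr A m q + q * twistBr A m p := by
    intro p q
    simp only [twistBr, LinearMap.mk₂_apply, Finset.mul_sum, ← Finset.sum_add_distrib]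
    refine Finset.sum_congr rfl fun i _ => ?_
    rw [Derivation.leibniz, smul_eq_mul, smul_eq_mul]; ring
  induction f using MvPolynomial.induction_on with
  | C c => simp [twistBr, quadBr_C, derivation_C]
  | add p q hp hq => rw [map_add, map_add, map_add, hp, hq]; ring
  | mul_X p j hp =>
    have hX : twistBr A m (X j) = quadBr A m (X j) + twistDer A (X j) * m := by
      rw [twistDer, mkDerivation_X, ← twistGen_eq hA, twistBr, LinearMap.mk₂_apply,
        Finset.sum_eq_single j]
      · simp
      · intro l _ hl; simp [pderiv_X, hl.symm]
      · simp
    rw [hL, hp, hX, quadBr_leibniz, Derivation.leibniz, smul_eq_mul, smul_eq_mul]; ring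

lemma twistDer_quadBr {A : Matrix (Fin n) (Fin n) ℤ} (hA : A.transpose = -A) (f g : Poly n) :
    twistDer A (quadBr A f g) = quadBr A (twistDer A f) g + quadBr A f (twistDer A g) := by
  have red : ∀ f : Poly n, (∀ l, twistDer A (quadBr A f (X l)) =
      quadBr A (twistDer A f) (X l) + quadBr A f (twistDer A (X l))) →
      ∀ g, twistDer A (quadBr A f g) = quadBr A (twistDer A f) g + quadBr A f (twistDer A g) := by
    intro f hl g
    induction g using MvPolynomial.induction_on with
    | C c => simp [quadBr_C, derivation_C]
    | add p q hp hq => simp only [map_add, hp, hq]; ring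
    | mul_X p j hp =>
      have h1 := hl j
      simp only [quadBr_leibniz, Derivation.leibniz, smul_eq_mul, map_add] at h1 ⊢
      linear_combination p * h1 + X j * hp
  have sk : ∀ f g : Poly n,
      twistDer A (quadBr A f g) = quadBr A (twistDer A f) g + quadBr A f (twistDer A g) →
      twistDer A (quadBr A g f) = quadBr A (twistDer A g) f + quadBr A g (twistDer A f) := by
    intro f g h
    rw [quadBr_skew hA g f, map_neg, h, quadBr_skew hA (twistDer A g) f,
      quadBr_skew hA g (twistDer A f)]
    ring
  refine red f (fun l => sk _ _ (red (X l) (fun i => ?_) f)) g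
  have hC : ∀ c : ℂ, ∀ f, quadBr A (C c) f = 0 := fun c f => by
    rw [quadBr_skew hA, quadBr_C, neg_zero]
  have hs : ∀ i, (∑ l, (A i l : Poly n)) = C (∑ l, (A i l : ℂ)) := by intro i; simp
  have hz : (A l i : Poly n) = C (A l i : ℂ) := by simp
  have hX : ∀ i, twistDer A (X i) = C (∑ l, (A i l : ℂ)) * X i := fun i => by
    rw [twistDer, mkDerivation_X, hs]
  simp only [hX, quadBr_X, hz, Derivation.leibniz, quadBr_leibniz,
    quadBr_leibniz_left hA, quadBr_C, hC, derivation_C, smul_eq_mul]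
  ring

/-- The Poisson module `M`: it is `R = ℂ[X_1, …, X_n]` as an `R`-module, with the external bracket
`{X^α, X_i}_M = -∑_j a_{ij} (α_j - 1) X^{α + ε_i}`. -/
def twistModule (A : Matrix (Fin n) (Fin n) ℤ) (hA : A.transpose = -A) :
    PoissonModule (quadBracket A hA) (Poly n) where
  br := twistBr A
  lie x a b := by
    have h := quadBr_jacobi hA x a b
    have h' := twistDer_quadBr hA a b
    simp only [twistBr_eq hA, quadBracket, h', map_add, LinearMap.add_apply,
      quadBr_leibniz_left hA]
    rw [quadBr_skew hA b x, map_neg, quadBr_skew hA a (quadBr A x b)] at h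
    rw [quadBr_skew hA (twistDer A b) a, quadBr_skew hA b (quadBr A x a)] at *
    linear_combination h
  smul_br x a b := by
    simp only [twistBr_eq hA, quadBracket, smul_eq_mul, quadBr_leibniz_left hA]
    rw [quadBr_skew hA b a]; ring
  br_mul x a b := by
    simp only [twistBr_eq hA, smul_eq_mul, quadBr_leibniz, Derivation.leibniz]; ring

open Classical in
/-- The set `S_{k,l}` of the permutations `σ` of `{1, …, n}`, `n = k + l`, with
`σ_1 < ⋯ < σ_k` and `σ_{k+1} < ⋯ < σ_n`. -/
def shuffles {k l : ℕ} (h : k + l = n) : Finset (Equiv.Perm (Fin n)) :=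
  Finset.univ.filter fun σ =>
    StrictMono (fun i : Fin k => σ (Fin.cast h (Fin.castAdd l i))) ∧
    StrictMono (fun j : Fin l => σ (Fin.cast h (Fin.natAdd k j)))

/-- The map `† : χ^k(R) → M ⊗_R Ω^l(R)`, `k + l = n`, for `M = R` as an `R`-module:
`†(P) = ∑_{σ ∈ S_{k,l}} ε(σ) P(X_{σ_1}, …, X_{σ_k}) ⊗ dX_{σ_{k+1}} ∧ ⋯ ∧ dX_{σ_n}`. -/
def dagger {k l : ℕ} (h : k + l = n) :
    Chi (Poly n) k →ₗ[ℂ] Chains (Poly n) (Poly n) l where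
  toFun P := ∑ σ ∈ shuffles h, (Equiv.Perm.sign σ : ℤ) •
    (P.1 (fun i => X (σ (Fin.cast h (Fin.castAdd l i)))) ⊗ₜ[Poly n]
      wedgeD (Poly n) l (fun j => X (σ (Fin.cast h (Fin.natAdd k j)))))
  map_add' P Q := by
    simp only [Chi.val_add, AlternatingMap.add_apply, TensorProduct.add_tmul, smul_add,
      Finset.sum_add_distrib]
  map_smul' c P := by
    simp only [Chi.val_smul, AlternatingMap.smul_apply, TensorProduct.smul_tmul',
      Finset.smul_sum, RingHom.id_apply, smul_comm c]

end Quadratic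

end PoissonDuality

end

open scoped TensorProduct

noncomputable section

namespace PoissonDuality

open MvPolynomial

/-! ### The bracket terms of the two differentials, evaluated at variables. -/

section PairSum

variable {n : ℕ} {N : Type*} [AddCommGroup N] [Module ℂ N] [Module (Poly n) N]

/-! The map `†` is a Hodge-star-like duality, and the twist of `M` is exactly what makes it commute
with the differentials up to sign.

Because `{X_p, X_q} = a_{pq} X_p X_q` and both multiderivations and wedges of differentials obey the
Leibniz rule, each pair term splits into `a_{pq} X_p` times a value with only `X_p` omitted, plus
the symmetric piece. Hence the bracket part at a tuple of variables collapses to single omissions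
weighted by row sums over that tuple (`pairSum_X`). Consequently `δ(P)` at `X_v` and `∂` at `P(X_w)
⊗ dX_u` are alternating sums of one common term `hamChain`, in which a variable `X_x` meets `P(X_w)`
with the correction `∑_j a_{x w_j}` (`coboundary_X`, `boundary_X`). For `δ` this correction comes
directly from the pair sum. For `∂` the pair sum gives the row sum over `u`, while the external
bracket gives the row sum over all indices; as `w` and `u` partition the indices, the sum over `w`
is left.

Signs are handled by replacing the sum over shuffles by `k! l!` times itself, a sum over all
permutations (`factorial_smul_dagger`). There every omission can be moved to a fixed position by a
cycle, so `δ` and `∂` give the same sum with the distinguished variable in position `0` or `k`. This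
yields `dagger_coboundary`.

Bijectivity is linear algebra: a multiderivation is given by arbitrary values on increasing
`k`-tuples, a chain by arbitrary coefficients on increasing `l`-tuples, and `†` matches
complementary subsets up to sign. The statement on homology follows, using that both complexes
vanish above degree `n`. -/

lemma map_cons_removeNth {R A : Type*} [CommRing R] [Algebra ℂ R] [AddCommGroup A] [Module ℂ A]
    {k : ℕ} (F : R [⋀^Fin (k + 1)]→ₗ[ℂ] A) (i : Fin (k + 1)) (w : Fin (k + 1) → R) :
    F (Matrix.vecCons (w i) (i.removeNth w)) = (-1 : ℤ) ^ (i : ℕ) • F w := by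
  have h := update_eq_of_cons F i w (w i)
  rw [Function.update_eq_self] at h
  rw [h, smul_smul, ← mul_pow]
  simp

/-- The bracket part of the Chevalley–Eilenberg sum at variables: the quadratic bracket is
diagonal on the monomial basis, so only rescaled omissions `X_p F(…, X̂_p, …)` remain. -/
lemma pairSum_X {A : Matrix (Fin n) (Fin n) ℤ} (hA : A.transpose = -A) {k : ℕ}
    (F : Poly n [⋀^Fin k]→ₗ[ℂ] N)
    (hF : ∀ (i : Fin k) (w : Fin k → Poly n) (b c : Poly n), F (Function.update w i (b * c)) =
      b • F (Function.update w i c) + c • F (Function.update w i b))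
    (v : Fin (k + 1) → Fin n) :
    pairSum (quadBracket A hA) k F (fun i => X (v i)) =
      -∑ p : Fin (k + 1), (-1 : ℤ) ^ (p : ℕ) • (∑ q, A (v p) (v q)) •
        (X (v p) : Poly n) • F (fun i => X (v (p.succAbove i))) := by
  have hsk : ∀ p q, A p q = - A q p := fun p q => by
    simpa using congrFun (congrFun hA q) p
  have hdiag : ∀ p, A p p = 0 := fun p => by have := hsk p p; omega
  cases k with
  | zero => simp [pairSum, hdiag]
  | succ k =>
    have key : ∀ i : Fin (k + 1), ∀ j ∈ Finset.Ici i, (-1 : ℤ) ^ (i + j + 1 : ℕ) •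
        F (Matrix.vecCons ((quadBracket A hA).br (X (v i.castSucc)) (X (v j.succ)))
          (j.removeNth (i.castSucc.removeNth fun i => X (v i)))) =
        -((-1 : ℤ) ^ (i.castSucc : ℕ) • A (v i.castSucc) (v (i.castSucc.succAbove j)) •
          (X (v i.castSucc) : Poly n) • F (fun r => X (v (i.castSucc.succAbove r)))) +
        -((-1 : ℤ) ^ (j.succ : ℕ) • A (v j.succ) (v (j.succ.succAbove i)) •
          (X (v j.succ) : Poly n) • F (fun r => X (v (j.succ.succAbove r)))) := by
      intro i j hij
      rw [Finset.mem_Ici] at hij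
      -- The pair of positions is `i < j + 1`. Once one of them is omitted, the other is entry `j`,
      -- respectively entry `i`, of what remains.
      have e1 : i.castSucc.succAbove j = j.succ := Fin.succAbove_castSucc_of_le _ _ hij
      have e2 : j.succ.succAbove i = i.castSucc := Fin.succAbove_succ_of_le _ _ hij
      have h1 := map_cons_removeNth F j (fun r => X (v (i.castSucc.succAbove r)))
      have h2 := map_cons_removeNth F i (fun r => X (v (j.succ.succAbove r)))
      have e3 : (i.removeNth fun r => (X (v (j.succ.succAbove r)) : Poly n)) =
          j.removeNth (i.castSucc.removeNth fun i => X (v i)) := by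
        funext r
        simp only [Fin.removeNth]
        congr 2
        ext
        simp only [Fin.succAbove, Fin.lt_def, Fin.val_castSucc, Fin.val_succ]
        rw [Fin.le_def] at hij
        split_ifs <;> simp at * <;> omega
      rw [e3, e2] at h2
      rw [e1] at h1
      have hup : ∀ (w : Fin k → Poly n) (y : Poly n), Matrix.vecCons y w =
          Function.update (Matrix.vecCons 0 w : Fin (k + 1) → Poly n) 0 y := by
        intro w y
        ext i
        refine Fin.cases ?_ (fun i => ?_) i <;> simp
      have h3 : ∀ (b c : Poly n) w, F (Matrix.vecCons (b * c) w) =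
          b • F (Matrix.vecCons c w) + c • F (Matrix.vecCons b w) := fun b c w => by
        rw [hup w (b * c), hup w c, hup w b, hF]
      -- The coefficient is written as a complex scalar so that `F` releases it by linearity; it is
      -- then turned into an integer scalar, which commutes with the polynomial action on `N`
      -- without any scalar tower.
      have h4 : (quadBracket A hA).br (X (v i.castSucc)) (X (v j.succ)) =
          (A (v i.castSucc) (v j.succ) : ℂ) • (X (v i.castSucc) * X (v j.succ)) := by
        change quadBr A _ _ = _
        rw [quadBr_X, smul_eq_C_mul, map_intCast, mul_assoc]
      have h5 : ∀ (c : ℂ) (y : Poly n) w, F (Matrix.vecCons (c • y) w) =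
          c • F (Matrix.vecCons y w) := fun c y w => by
        rw [hup w (c • y), hup w y, F.map_update_smul]
      have h1' : F (Matrix.vecCons (X (v j.succ))
          (j.removeNth (i.castSucc.removeNth fun i => X (v i)))) = _ := h1
      rw [h4, h5, h3, h2, h1', e1, e2, hsk (v j.succ), Int.cast_smul_eq_zsmul]
      simp only [Fin.val_castSucc, Fin.val_succ, smul_comm (_ : Poly n) (_ : ℤ), pow_add]
      rcases neg_one_pow_eq_or ℤ (i : ℕ) with h | h <;>
        rcases neg_one_pow_eq_or ℤ (j : ℕ) with h' | h' <;> rw [h, h'] <;> module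
    -- The two halves of the pairs `i ≤ j` together run once over all ordered pairs of distinct
    -- positions, the first being the omitted one.
    rw [pairSum, Finset.sum_congr rfl fun i _ => Finset.sum_congr rfl (key i),
      ← Fin.sum_sum_eq_sum_triangle_add (fun (p : Fin (k + 2)) (q : Fin (k + 1)) =>
        -((-1 : ℤ) ^ (p : ℕ) • A (v p) (v (p.succAbove q)) •
          (X (v p) : Poly n) • F (fun r => X (v (p.succAbove r))))), ← Finset.sum_neg_distrib]
    refine Finset.sum_congr rfl fun p _ => ?_
    -- The missing diagonal term is zero, so the row sum may run over the whole tuple.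
    rw [Fin.sum_univ_succAbove _ p, hdiag, zero_add, Finset.sum_smul, Finset.smul_sum,
      Finset.sum_neg_distrib]

end PairSum

/-! ### Shuffles as coset representatives for the permutations preserving the two blocks. -/

section Shuffles

variable {n : ℕ}

/-- The identification of `{1, …, k} ⊔ {1, …, l}` with `{1, …, n}`, `n = k + l`. -/
def blockEquiv {k l : ℕ} (h : k + l = n) : Fin k ⊕ Fin l ≃ Fin n :=
  finSumFinEquiv.trans (finCongr h)

/-- The permutation of `{1, …, n}` acting by `τ` on the first block and by `ρ` on the second. -/
def blockPerm {k l : ℕ} (h : k + l = n) (τ : Equiv.Perm (Fin k)) (ρ : Equiv.Perm (Fin l)) :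
    Equiv.Perm (Fin n) :=
  (blockEquiv h).permCongr (Equiv.sumCongr τ ρ)

lemma blockPerm_inl {k l : ℕ} (h : k + l = n) (τ : Equiv.Perm (Fin k)) (ρ : Equiv.Perm (Fin l))
    (i : Fin k) : blockPerm h τ ρ (blockEquiv h (.inl i)) = blockEquiv h (.inl (τ i)) := by
  simp [blockPerm, Equiv.permCongr_apply]

lemma blockPerm_inr {k l : ℕ} (h : k + l = n) (τ : Equiv.Perm (Fin k)) (ρ : Equiv.Perm (Fin l))
    (i : Fin l) : blockPerm h τ ρ (blockEquiv h (.inr i)) = blockEquiv h (.inr (ρ i)) := by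
  simp [blockPerm, Equiv.permCongr_apply]

lemma sign_blockPerm {k l : ℕ} (h : k + l = n) (τ : Equiv.Perm (Fin k))
    (ρ : Equiv.Perm (Fin l)) :
    Equiv.Perm.sign (blockPerm h τ ρ) = Equiv.Perm.sign τ * Equiv.Perm.sign ρ := by
  rw [blockPerm, Equiv.Perm.sign_permCongr]
  exact Equiv.Perm.sign_sumCongr τ ρ

lemma mem_shuffles {k l : ℕ} (h : k + l = n) (σ : Equiv.Perm (Fin n)) :
    σ ∈ shuffles h ↔ StrictMono (fun i => σ (blockEquiv h (.inl i))) ∧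
      StrictMono (fun j => σ (blockEquiv h (.inr j))) := by
  rw [shuffles, Finset.mem_filter]
  exact and_iff_right (Finset.mem_univ σ)

lemma perm_ext_block {k l : ℕ} (h : k + l = n) {σ σ' : Equiv.Perm (Fin n)}
    (h₁ : ∀ i, σ (blockEquiv h (.inl i)) = σ' (blockEquiv h (.inl i)))
    (h₂ : ∀ i, σ (blockEquiv h (.inr i)) = σ' (blockEquiv h (.inr i))) : σ = σ' := by
  refine Equiv.ext fun x => ?_
  obtain ⟨y, rfl⟩ := (blockEquiv h).surjective x
  cases y with
  | inl i => exact h₁ i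
  | inr i => exact h₂ i

lemma range_inr_eq_compl {k l : ℕ} (h : k + l = n) (σ : Equiv.Perm (Fin n)) :
    Set.range (fun j => σ (blockEquiv h (.inr j))) =
      (Set.range fun i => σ (blockEquiv h (.inl i)))ᶜ := by
  have : Function.Bijective fun x => σ (blockEquiv h x) :=
    σ.bijective.comp (blockEquiv h).bijective
  rw [show (fun j => σ (blockEquiv h (.inr j))) = (fun x => σ (blockEquiv h x)) ∘ Sum.inr from rfl,
    show (fun j => σ (blockEquiv h (.inl j))) = (fun x => σ (blockEquiv h x)) ∘ Sum.inl from rfl,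
    Set.range_comp, Set.range_comp, ← Set.image_compl_eq this, Set.compl_range_inl]

/-- A shuffle is determined by the image of its first block. -/
lemma shuffle_ext_left {k l : ℕ} (h : k + l = n) {σ σ' : Equiv.Perm (Fin n)}
    (hσ : σ ∈ shuffles h) (hσ' : σ' ∈ shuffles h)
    (hr : Set.range (fun i => σ (blockEquiv h (.inl i))) =
      Set.range fun i => σ' (blockEquiv h (.inl i))) : σ = σ' := by
  rw [mem_shuffles] at hσ hσ'
  refine perm_ext_block h (congrFun ((hσ.1.range_inj hσ'.1).1 hr))
    (congrFun ((hσ.2.range_inj hσ'.2).1 ?_))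
  rw [range_inr_eq_compl, range_inr_eq_compl, hr]

/-- A shuffle is determined by the image of its second block. -/
lemma shuffle_ext_right {k l : ℕ} (h : k + l = n) {σ σ' : Equiv.Perm (Fin n)}
    (hσ : σ ∈ shuffles h) (hσ' : σ' ∈ shuffles h)
    (hr : Set.range (fun i => σ (blockEquiv h (.inr i))) =
      Set.range fun i => σ' (blockEquiv h (.inr i))) : σ = σ' := by
  refine shuffle_ext_left h hσ hσ' ?_
  rwa [range_inr_eq_compl, range_inr_eq_compl, compl_inj_iff] at hr

/-- List `s` in increasing order, then its complement in increasing order. -/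
lemma exists_shuffle_left {k l : ℕ} (h : k + l = n) (s : Finset (Fin n)) (hs : s.card = k) :
    ∃ σ ∈ shuffles h, ∀ i, σ (blockEquiv h (.inl i)) = s.orderEmbOfFin hs i := by
  have hc : sᶜ.card = l := by rw [Finset.card_compl, Fintype.card_fin]; omega
  refine ⟨(blockEquiv h).symm.trans (finSumEquivOfFinset hs hc), ?_, fun i => by simp⟩
  rw [mem_shuffles]
  simpa using ⟨(s.orderEmbOfFin hs).strictMono, (sᶜ.orderEmbOfFin hc).strictMono⟩

lemma exists_shuffle_right {k l : ℕ} (h : k + l = n) (s : Finset (Fin n)) (hs : s.card = l) :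
    ∃ σ ∈ shuffles h, ∀ i, σ (blockEquiv h (.inr i)) = s.orderEmbOfFin hs i := by
  have hc : sᶜ.card = k := by rw [Finset.card_compl, Fintype.card_fin]; omega
  obtain ⟨σ, hσ, hσs⟩ := exists_shuffle_left h sᶜ hc
  refine ⟨σ, hσ, congrFun ((((mem_shuffles h σ).1 hσ).2.range_inj
    (s.orderEmbOfFin hs).strictMono).1 ?_)⟩
  rw [range_inr_eq_compl, funext hσs]
  simp

/-- Every permutation is uniquely a shuffle followed (on the right) by permutations of the two
blocks. -/
lemma sum_perm_eq_sum_shuffles {A : Type*} [AddCommGroup A] {k l : ℕ} (h : k + l = n)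
    (F : Equiv.Perm (Fin n) → A) (hF : ∀ σ τ ρ, F (σ * blockPerm h τ ρ) = F σ) :
    ∑ σ, F σ = (k.factorial * l.factorial) • ∑ σ ∈ shuffles h, F σ := by
  have hcard : k.factorial * l.factorial =
      (Finset.univ : Finset (Equiv.Perm (Fin k) × Equiv.Perm (Fin l))).card := by
    rw [Finset.card_univ, Fintype.card_prod, Fintype.card_perm, Fintype.card_perm,
      Fintype.card_fin, Fintype.card_fin]
  rw [hcard, Finset.smul_sum]
  simp only [← Finset.sum_const]
  rw [← Finset.sum_product', eq_comm]
  have hl : ∀ (σ : Equiv.Perm (Fin n)) (τ : Equiv.Perm (Fin k)) (ρ : Equiv.Perm (Fin l)),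
      (fun i => (σ * blockPerm h τ ρ) (blockEquiv h (.inl i))) =
        (fun i => σ (blockEquiv h (.inl i))) ∘ τ := fun σ τ ρ => by
    funext i; simp [blockPerm_inl]
  have hr : ∀ (σ : Equiv.Perm (Fin n)) (τ : Equiv.Perm (Fin k)) (ρ : Equiv.Perm (Fin l)),
      (fun i => (σ * blockPerm h τ ρ) (blockEquiv h (.inr i))) =
        (fun i => σ (blockEquiv h (.inr i))) ∘ ρ := fun σ τ ρ => by
    funext i; simp [blockPerm_inr]
  refine Finset.sum_bij (fun p _ => p.1 * blockPerm h p.2.1 p.2.2) (fun _ _ => Finset.mem_univ _)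
    ?_ ?_ (fun p _ => (hF _ _ _).symm)
  · rintro ⟨σ, τ, ρ⟩ hp ⟨σ', τ', ρ'⟩ hp' he
    simp only [Finset.mem_product, Finset.mem_univ, and_true] at hp hp' he
    have e1 := hl σ τ ρ
    have e2 := hr σ τ ρ
    rw [he] at e1 e2
    rw [hl] at e1
    rw [hr] at e2
    -- Permuting a block does not change its image, and the image of the first block determines the
    -- shuffle.
    obtain rfl : σ = σ' := shuffle_ext_left h hp hp' <| by
      rw [← τ.surjective.range_comp, ← e1, τ'.surjective.range_comp]
    have e1' := fun i => congrFun e1 i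
    have e2' := fun i => congrFun e2 i
    simp only [Function.comp_apply, EmbeddingLike.apply_eq_iff_eq, Sum.inl.injEq,
      Sum.inr.injEq] at e1' e2'
    rw [Equiv.ext e1', Equiv.ext e2']
  · intro π _
    have i1 : Function.Injective (fun i => π (blockEquiv h (.inl i))) :=
      π.injective.comp ((blockEquiv h).injective.comp Sum.inl_injective)
    have i2 : Function.Injective (fun i => π (blockEquiv h (.inr i))) :=
      π.injective.comp ((blockEquiv h).injective.comp Sum.inr_injective)
    -- Sorting each block of `π` produces its shuffle; the inverse sorting permutations recover `π`.
    set τ := Tuple.sort (fun i => π (blockEquiv h (.inl i)))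
    set ρ := Tuple.sort (fun i => π (blockEquiv h (.inr i)))
    refine ⟨(π * blockPerm h τ ρ, τ⁻¹, ρ⁻¹), ?_, ?_⟩
    · simp only [Finset.mem_product, Finset.mem_univ, and_true]
      rw [mem_shuffles, hl, hr]
      exact ⟨(Tuple.monotone_sort _).strictMono_of_injective (i1.comp τ.injective),
        (Tuple.monotone_sort _).strictMono_of_injective (i2.comp ρ.injective)⟩
    · refine perm_ext_block h (fun i => ?_) fun i => ?_
      · simp [blockPerm_inl]
      · simp [blockPerm_inr]

/-- Substituting `σ * b` for `σ` changes the sign weight by `sign b`, which is its own inverse. -/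
lemma sum_perm_mul_right {A : Type*} [AddCommGroup A] (F : Equiv.Perm (Fin n) → A)
    (b : Equiv.Perm (Fin n)) :
    ∑ σ : Equiv.Perm (Fin n), (Equiv.Perm.sign σ : ℤ) • F (σ * b) =
      (Equiv.Perm.sign b : ℤ) • ∑ σ : Equiv.Perm (Fin n), (Equiv.Perm.sign σ : ℤ) • F σ := by
  rw [Finset.smul_sum, ← Equiv.sum_comp (Equiv.mulRight b) fun σ =>
    (Equiv.Perm.sign b : ℤ) • (Equiv.Perm.sign σ : ℤ) • F σ]
  refine Finset.sum_congr rfl fun σ _ => ?_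
  rw [Equiv.coe_mulRight, Equiv.Perm.sign_mul, smul_smul, Units.val_mul, mul_left_comm,
    ← Units.val_mul, Int.units_mul_self, Units.val_one, mul_one]

end Shuffles

/-! ### Comparison of the two differentials through `†`. -/

section Commutation

variable {n : ℕ}

/-- The chain
`({X_x, P(X_{w_1}, …, X_{w_k})} - ∑_j a_{x w_j} X_x P(X_{w_1}, …)) ⊗ dX_{u_1} ∧ ⋯ ∧ dX_{u_l}`,
which is the common term of `δ` and `∂` at variables. -/
def hamChain (A : Matrix (Fin n) (Fin n) ℤ) {k l : ℕ} (P : Chi (Poly n) k) (x : Fin n)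
    (w : Fin k → Fin n) (u : Fin l → Fin n) : Chains (Poly n) (Poly n) l :=
  (quadBr A (X x) (P.1 fun i => X (w i)) - (∑ j, A x (w j)) • (X x * P.1 fun i => X (w i)))
    ⊗ₜ[Poly n] wedgeD (Poly n) l fun i => X (u i)

lemma entry_diag {A : Matrix (Fin n) (Fin n) ℤ} (hA : A.transpose = -A) (p : Fin n) :
    A p p = 0 := by
  have := congrFun (congrFun hA p) p
  simp only [Matrix.transpose_apply, Matrix.neg_apply] at this
  omega

lemma coboundary_X {A : Matrix (Fin n) (Fin n) ℤ} (hA : A.transpose = -A) {k l : ℕ}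
    (P : Chi (Poly n) k) (v : Fin (k + 1) → Fin n) (u : Fin l → Fin n) :
    ((coboundary (quadBracket A hA) k P).1 fun i => X (v i)) ⊗ₜ[Poly n]
        wedgeD (Poly n) l (fun i => X (u i)) =
      ∑ i : Fin (k + 1), (-1 : ℤ) ^ (i : ℕ) •
        hamChain A P (v i) (fun j => v (i.succAbove j)) u := by
  rw [coboundary_apply, pairSum_X hA P.1 (fun i w b c => P.2 i w b c), ← Finset.sum_neg_distrib,
    ← Finset.sum_add_distrib, TensorProduct.sum_tmul]
  refine Finset.sum_congr rfl fun i _ => ?_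
  -- Dropping the zero entry `a_{v_i v_i}` leaves the row sum over the other arguments, as
  -- `hamChain` requires.
  rw [Fin.sum_univ_succAbove _ i, entry_diag hA, zero_add, ← smul_neg, ← smul_add,
    ← sub_eq_add_neg]
  exact map_zsmul ((TensorProduct.mk (Poly n) (Poly n) _).flip _) _ _

/-- The twist enters here. The external bracket with `X_x` is `-{X_x, m}` plus the full row sum
times `X_x m`; by `hwu` that row sum splits into a `w` part and a `u` part, and the pair sum cancels
the `u` part. The rest is minus `hamChain`. -/
lemma boundary_X {A : Matrix (Fin n) (Fin n) ℤ} (hA : A.transpose = -A) {k l : ℕ}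
    (P : Chi (Poly n) k) (w : Fin k → Fin n) (u : Fin (l + 1) → Fin n)
    (hwu : ∀ x, ∑ r, A x r = ∑ j, A x (w j) + ∑ j, A x (u j)) :
    boundary (twistModule A hA) l ((P.1 fun i => X (w i)) ⊗ₜ[Poly n]
        wedgeD (Poly n) (l + 1) fun i => X (u i)) =
      -∑ i : Fin (l + 1), (-1 : ℤ) ^ (i : ℕ) •
        hamChain A P (u i) w (fun j => u (i.succAbove j)) := by
  set m := P.1 fun i => X (w i) with hm
  have h1 := pairSum_X hA (chainAlt (Poly n) l m) (fun i w b c => by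
    simp only [chainAlt_apply, wedgeD_mul, TensorProduct.tmul_add, TensorProduct.tmul_smul]) u
  simp only [chainAlt_apply] at h1
  rw [boundary_tmul]
  refine (congrArg _ h1).trans ?_
  rw [← Finset.sum_neg_distrib, ← Finset.sum_neg_distrib, ← Finset.sum_add_distrib]
  refine Finset.sum_congr rfl fun i _ => ?_
  have h2 : (twistModule A hA).br m (X (u i)) = - quadBr A (X (u i)) m +
      (∑ j, A (u i) (w j) + ∑ j, A (u i) (u j)) • (X (u i) * m) := by
    change twistBr A m (X (u i)) = _
    rw [twistBr_eq hA, quadBr_skew hA m, ← hwu, twistDer, mkDerivation_X, zsmul_eq_mul]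
    push_cast
    ring
  have e1 : (i.removeNth fun i => (X (u i) : Poly n)) = fun j => X (u (i.succAbove j)) := rfl
  have e2 : ∀ y : ⋀[Poly n]^l (Ω[Poly n⁄ℂ]), (X (u i) : Poly n) • (m ⊗ₜ[Poly n] y) =
    (X (u i) * m) ⊗ₜ[Poly n] y := fun y => rfl
  rw [h2, hamChain, ← hm, add_smul, sub_eq_add_neg, e1, e2]
  simp only [TensorProduct.add_tmul, TensorProduct.neg_tmul, ← TensorProduct.smul_tmul',
    smul_add, smul_neg, neg_add, neg_neg]
  abel

/-- The sum over all permutations which is `k! l!` times `†`. -/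
lemma factorial_smul_dagger {k l : ℕ} (h : k + l = n) (P : Chi (Poly n) k) :
    (k.factorial * l.factorial) • dagger h P =
      ∑ σ : Equiv.Perm (Fin n), (Equiv.Perm.sign σ : ℤ) •
        ((P.1 fun i => X (σ (blockEquiv h (.inl i)))) ⊗ₜ[Poly n]
          wedgeD (Poly n) l fun j => X (σ (blockEquiv h (.inr j)))) := by
  rw [sum_perm_eq_sum_shuffles h]
  · rfl
  · intro σ τ ρ
    have e1 := P.1.map_perm (fun i => X (σ (blockEquiv h (.inl i)))) τ
    have e2 := (wedgeD (Poly n) l).map_perm (fun i => X (σ (blockEquiv h (.inr i)))) ρ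
    simp only [Equiv.Perm.mul_apply, blockPerm_inl, blockPerm_inr]
    simp only [Function.comp_def, Units.smul_def] at e1 e2
    rw [e1, e2, Equiv.Perm.sign_mul, sign_blockPerm]
    simp only [← TensorProduct.smul_tmul', TensorProduct.tmul_smul, smul_smul, ← Units.val_mul]
    congr 2
    -- The signs of `τ` and `ρ` occur twice, once from the block permutation and once from
    -- alternation, and cancel.
    rcases Int.units_eq_one_or (Equiv.Perm.sign τ) with h | h <;>
      rcases Int.units_eq_one_or (Equiv.Perm.sign ρ) with h' | h' <;> simp [h, h']

/-- The inverse of `i.cycleRange` sends `0` to `i` and `j.succ` to `i.succAbove j`, and its sign is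
`(-1)^i`; reindexing by it on the first block moves the distinguished argument to the front. -/
lemma sum_move_left {B : Type*} [AddCommGroup B] {k l : ℕ} (h : (k + 1) + l = n)
    (g : Fin n → (Fin k → Fin n) → (Fin l → Fin n) → B) (i : Fin (k + 1)) :
    ∑ σ : Equiv.Perm (Fin n), (Equiv.Perm.sign σ : ℤ) •
        g (σ (blockEquiv h (.inl i))) (fun j => σ (blockEquiv h (.inl (i.succAbove j))))
          (fun j => σ (blockEquiv h (.inr j))) =
      (-1 : ℤ) ^ (i : ℕ) • ∑ σ : Equiv.Perm (Fin n), (Equiv.Perm.sign σ : ℤ) •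
        g (σ (blockEquiv h (.inl 0))) (fun j => σ (blockEquiv h (.inl j.succ)))
          (fun j => σ (blockEquiv h (.inr j))) := by
  have := sum_perm_mul_right (fun σ => g (σ (blockEquiv h (.inl 0)))
    (fun j => σ (blockEquiv h (.inl j.succ))) (fun j => σ (blockEquiv h (.inr j))))
    (blockPerm h i.cycleRange.symm 1)
  simpa [blockPerm_inl, blockPerm_inr, sign_blockPerm] using this

lemma sum_move_right {B : Type*} [AddCommGroup B] {k l : ℕ} (h : k + (l + 1) = n)
    (g : Fin n → (Fin k → Fin n) → (Fin l → Fin n) → B) (i : Fin (l + 1)) :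
    ∑ σ : Equiv.Perm (Fin n), (Equiv.Perm.sign σ : ℤ) •
        g (σ (blockEquiv h (.inr i))) (fun j => σ (blockEquiv h (.inl j)))
          (fun j => σ (blockEquiv h (.inr (i.succAbove j)))) =
      (-1 : ℤ) ^ (i : ℕ) • ∑ σ : Equiv.Perm (Fin n), (Equiv.Perm.sign σ : ℤ) •
        g (σ (blockEquiv h (.inr 0))) (fun j => σ (blockEquiv h (.inl j)))
          (fun j => σ (blockEquiv h (.inr j.succ))) := by
  have := sum_perm_mul_right (fun σ => g (σ (blockEquiv h (.inr 0)))
    (fun j => σ (blockEquiv h (.inl j))) (fun j => σ (blockEquiv h (.inr j.succ))))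
    (blockPerm h 1 i.cycleRange.symm)
  simpa [blockPerm_inl, blockPerm_inr, sign_blockPerm] using this

lemma neg_one_pow_smul_smul {B : Type*} [AddCommGroup B] (i : ℕ) (x : B) :
    (-1 : ℤ) ^ i • (-1 : ℤ) ^ i • x = x := by
  rw [smul_smul, ← mul_pow]; simp

/-- After symmetrisation the `k + 1` omissions contribute equally, since the sign of each cancels
the sign of the cycle moving it to the front. The factor `k + 1` turns `(k + 1)!` into `k!` and is
cancelled over `ℂ`. -/
lemma smul_dagger_coboundary {A : Matrix (Fin n) (Fin n) ℤ} (hA : A.transpose = -A) {k l : ℕ}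
    (h : (k + 1) + l = n) (P : Chi (Poly n) k) :
    (k.factorial * l.factorial) • dagger h (coboundary (quadBracket A hA) k P) =
      ∑ σ : Equiv.Perm (Fin n), (Equiv.Perm.sign σ : ℤ) •
        hamChain A P (σ (blockEquiv h (.inl 0))) (fun j => σ (blockEquiv h (.inl j.succ)))
          (fun j => σ (blockEquiv h (.inr j))) := by
  have hk : ((k + 1 : ℕ) : ℂ) ≠ 0 := Nat.cast_ne_zero.2 k.succ_ne_zero
  rw [← smul_right_inj hk, Nat.cast_smul_eq_nsmul, Nat.cast_smul_eq_nsmul, smul_smul, ← mul_assoc,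
    ← Nat.factorial_succ, factorial_smul_dagger]
  simp only [coboundary_X hA, Finset.smul_sum]
  rw [Finset.sum_comm]
  simp only [smul_comm (Equiv.Perm.sign _ : ℤ) ((-1 : ℤ) ^ _)]
  simp only [← Finset.smul_sum]
  simp only [sum_move_left h (hamChain A P), neg_one_pow_smul_smul, Finset.sum_const,
    Finset.card_univ, Fintype.card_fin]

lemma smul_boundary_dagger {A : Matrix (Fin n) (Fin n) ℤ} (hA : A.transpose = -A) {k l : ℕ}
    (h : k + (l + 1) = n) (P : Chi (Poly n) k) :
    (k.factorial * l.factorial) • boundary (twistModule A hA) l (dagger h P) =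
      -∑ σ : Equiv.Perm (Fin n), (Equiv.Perm.sign σ : ℤ) •
        hamChain A P (σ (blockEquiv h (.inr 0))) (fun j => σ (blockEquiv h (.inl j)))
          (fun j => σ (blockEquiv h (.inr j.succ))) := by
  have hl : ((l + 1 : ℕ) : ℂ) ≠ 0 := Nat.cast_ne_zero.2 l.succ_ne_zero
  have hwu : ∀ (σ : Equiv.Perm (Fin n)) x, ∑ r, A x r =
      ∑ j, A x (σ (blockEquiv h (.inl j))) + ∑ j, A x (σ (blockEquiv h (.inr j))) := by
    intro σ x
    rw [← Equiv.sum_comp ((blockEquiv h).trans σ), Fintype.sum_sum_type]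
    rfl
  rw [← smul_right_inj hl, Nat.cast_smul_eq_nsmul, Nat.cast_smul_eq_nsmul, smul_smul,
    mul_left_comm, ← Nat.factorial_succ, ← map_nsmul, factorial_smul_dagger, map_sum]
  simp only [map_zsmul, boundary_X hA P _ _ (hwu _), smul_neg, Finset.sum_neg_distrib]
  simp only [Finset.smul_sum]
  rw [Finset.sum_comm]
  simp only [smul_comm (Equiv.Perm.sign _ : ℤ) ((-1 : ℤ) ^ _)]
  simp only [← Finset.smul_sum]
  simp only [sum_move_right h (hamChain A P), neg_one_pow_smul_smul, Finset.sum_const,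
    Finset.card_univ, Fintype.card_fin]

/-- `†` intertwines `δ` and `∂` up to sign. -/
theorem dagger_coboundary {A : Matrix (Fin n) (Fin n) ℤ} (hA : A.transpose = -A) {k l : ℕ}
    (h : k + (l + 1) = n) (h' : (k + 1) + l = n) (P : Chi (Poly n) k) :
    dagger h' (coboundary (quadBracket A hA) k P) =
      (-1 : ℤ) ^ (k + 1) • boundary (twistModule A hA) l (dagger h P) := by
  have hc : ((k.factorial * l.factorial : ℕ) : ℂ) ≠ 0 :=
    Nat.cast_ne_zero.2 (mul_ne_zero k.factorial_ne_zero l.factorial_ne_zero)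
  rw [← smul_right_inj hc, Nat.cast_smul_eq_nsmul, Nat.cast_smul_eq_nsmul,
    smul_comm _ ((-1 : ℤ) ^ (k + 1)), smul_dagger_coboundary, smul_boundary_dagger]
  have hmove := sum_move_left h' (hamChain A P) (Fin.last k)
  -- Position `k` ends the first block of `(k + 1) + l` and begins the second block of `k + (l +
  -- 1)`. Moving the distinguished variable there from position `0` costs `(-1)^k`; the minus sign
  -- in `smul_boundary_dagger` supplies the remaining factor.
  have e1 : blockEquiv h' (.inl (Fin.last k)) = blockEquiv h (.inr 0) := by
    ext; simp [blockEquiv]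
  have e2 : ∀ j : Fin k, blockEquiv h' (.inl ((Fin.last k).succAbove j)) =
      blockEquiv h (.inl j) := fun j => by ext; simp [blockEquiv]
  have e3 : ∀ j : Fin l, blockEquiv h' (.inr j) = blockEquiv h (.inr j.succ) := fun j => by
    ext; simp [blockEquiv]; omega
  simp only [e1, e2, Fin.val_last] at hmove
  rw [pow_succ, mul_neg_one, neg_smul, smul_neg, neg_neg]
  simp only [← e3]
  rw [hmove, neg_one_pow_smul_smul]

end Commutation

open Set.powersetCard

/-! ### Bijectivity of `†` and vanishing above degree `n`. -/

section Bijective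

variable {n : ℕ}

lemma wedgeD_X_eq_formBasis {k : ℕ} {v : Fin k → Fin n} (hv : StrictMono v) :
    wedgeD (Poly n) k (fun i => X (v i)) =
      formBasis n k (ofFinEmbEquiv (OrderEmbedding.ofStrictMono v hv)) := by
  rw [formBasis, exteriorPower.basis_apply, exteriorPower.ιMulti_family]
  simp only [wedgeD, AlternatingMap.coe_mk, MultilinearMap.coe_mk]
  congr 1
  funext i
  simp

lemma coord_wedgeD_X {k : ℕ} {v w : Fin k → Fin n} (hv : StrictMono v) (hw : StrictMono w) :
    (formBasis n k).coord (ofFinEmbEquiv (OrderEmbedding.ofStrictMono w hw))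
      (wedgeD (Poly n) k fun i => X (v i)) = if v = w then 1 else 0 := by
  classical
  rw [wedgeD_X_eq_formBasis hv, Module.Basis.coord_apply, Module.Basis.repr_self,
    Finsupp.single_apply]
  refine if_congr ?_ rfl rfl
  rw [EmbeddingLike.apply_eq_iff_eq]
  exact ⟨fun h => funext fun i => DFunLike.congr_fun h i, fun h => by subst h; rfl⟩

/-- A tuple with a repetition is killed by alternation; any other one can be sorted at the cost of a
sign. -/
lemma alternating_X_eq_zero {N : Type*} [AddCommGroup N] [Module ℂ N] {k : ℕ}
    (F : Poly n [⋀^Fin k]→ₗ[ℂ] N)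
    (hF : ∀ v : Fin k → Fin n, StrictMono v → F (fun i => X (v i)) = 0) (v : Fin k → Fin n) :
    F (fun i => X (v i)) = 0 := by
  by_cases hv : Function.Injective v
  · have hp := F.map_perm (fun i => X (v i)) (Tuple.sort v)
    have h0 : F ((fun i => (X (v i) : Poly n)) ∘ Tuple.sort v) = 0 :=
      hF _ ((Tuple.monotone_sort v).strictMono_of_injective (hv.comp (Tuple.sort v).injective))
    rw [h0] at hp
    exact (smul_eq_zero_iff_eq _).1 hp.symm
  · rw [Function.Injective] at hv
    push Not at hv
    obtain ⟨i, j, hij, hne⟩ := hv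
    exact F.map_eq_zero_of_eq _ (by simp [hij]) hne

/-- A multiderivation is determined by its values on increasing tuples of variables. -/
lemma Chi.eq_zero {k : ℕ} (P : Chi (Poly n) k)
    (hP : ∀ v : Fin k → Fin n, StrictMono v → P.1 (fun i => X (v i)) = 0) : P = 0 := by
  -- The extra factor `m` absorbs the coefficients produced by the Leibniz rule, which puts `P` in
  -- the form needed by `eq_zero_of_leibniz`; the case `m = 1` gives back `P`.
  let T : Poly n →ₗ[ℂ] Poly n [⋀^Fin k]→ₗ[ℂ] Poly n :=
    { toFun := fun m => (LinearMap.mulLeft ℂ m).compAlternatingMap P.1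
      map_add' := fun x y => by ext; simp [add_mul]
      map_smul' := fun c x => by ext; simp }
  have hT : ∀ m a, T m a = m * P.1 a := fun _ _ => rfl
  refine Chi.ext' fun f => ?_
  have := eq_zero_of_leibniz T (fun m i a b c => by
    rw [hT, hT, hT, P.2 i a b c, smul_eq_mul, smul_eq_mul]; ring)
    (fun m v => by rw [hT, alternating_X_eq_zero P.1 hP v, mul_zero]) 1 f
  rwa [hT, one_mul] at this

/-- The multiderivation `(f_1, …, f_k) ↦ φ(df_1 ∧ ⋯ ∧ df_k)`. -/
def Chi.ofForm {k : ℕ} (φ : ⋀[Poly n]^k (Ω[Poly n⁄ℂ]) →ₗ[Poly n] Poly n) : Chi (Poly n) k :=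
  ⟨(φ.restrictScalars ℂ).compAlternatingMap (wedgeD (Poly n) k), fun i f a b => by
    simp [wedgeD_mul]⟩

lemma Chi.ofForm_apply {k : ℕ} (φ : ⋀[Poly n]^k (Ω[Poly n⁄ℂ]) →ₗ[Poly n] Poly n) (f) :
    (Chi.ofForm φ).1 f = φ (wedgeD (Poly n) k f) := rfl

lemma dagger_apply {k l : ℕ} (h : k + l = n) (P : Chi (Poly n) k) :
    dagger h P = ∑ σ ∈ shuffles h, (Equiv.Perm.sign σ : ℤ) •
      ((P.1 fun i => X (σ (blockEquiv h (.inl i)))) ⊗ₜ[Poly n]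
        wedgeD (Poly n) l fun j => X (σ (blockEquiv h (.inr j)))) := rfl

/-- The value of `P` at an increasing tuple is, up to sign, the coefficient of `†(P)` at the form on
the complementary variables, because a single shuffle contributes to that coefficient. -/
lemma dagger_injective {k l : ℕ} (h : k + l = n) : Function.Injective (dagger h) := by
  rw [injective_iff_map_eq_zero]
  intro P hP
  refine Chi.eq_zero P fun v hv => ?_
  obtain ⟨σ, hσ, hσv⟩ := exists_shuffle_left h (Finset.univ.map ⟨v, hv.injective⟩) (by simp)
  have hv' : v = fun i => σ (blockEquiv h (.inl i)) := by
    rw [funext hσv]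
    exact Finset.orderEmbOfFin_unique _ (fun x => by simp) hv
  have hσ' := ((mem_shuffles h σ).1 hσ).2
  have hc := congrArg (chainCoeff (Poly n)
    (ofFinEmbEquiv (OrderEmbedding.ofStrictMono _ hσ'))) hP
  rw [dagger_apply, map_zero, map_sum, Finset.sum_eq_single_of_mem σ hσ] at hc
  · simp only [map_zsmul, chainCoeff, LinearMap.comp_apply, LinearMap.lTensor_tmul,
      coord_wedgeD_X hσ' hσ'] at hc
    rw [hv']
    rcases Int.units_eq_one_or (Equiv.Perm.sign σ) with hs | hs <;> simpa [hs] using hc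
  · intro τ hτ hne
    have hτ' := ((mem_shuffles h τ).1 hτ).2
    have : (fun j => τ (blockEquiv h (.inr j))) ≠ fun j => σ (blockEquiv h (.inr j)) :=
      fun he => hne (shuffle_ext_right h hτ hσ (by rw [he]))
    simp only [map_zsmul, chainCoeff, LinearMap.comp_apply, LinearMap.lTensor_tmul,
      coord_wedgeD_X hτ' hσ', if_neg this]
    simp

lemma dagger_surjective {k l : ℕ} (h : k + l = n) : Function.Surjective (dagger h) := by
  have key : ∀ (m : Poly n) (s : Set.powersetCard (Fin n) l),
      m ⊗ₜ[Poly n] formBasis n l s ∈ LinearMap.range (dagger h) := by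
    intro m s
    obtain ⟨σ, hσ, hσs⟩ := exists_shuffle_right h s.1 s.2
    have hσ' := (mem_shuffles h σ).1 hσ
    have hs : formBasis n l s = wedgeD (Poly n) l fun j => X (σ (blockEquiv h (.inr j))) := by
      rw [wedgeD_X_eq_formBasis hσ'.2]
      congr 1
      rw [← Equiv.symm_apply_eq]
      exact RelEmbedding.ext fun i => (hσs i).symm
    -- The dual basis form on the complement of `s` is nonzero on the first block of `σ` alone among
    -- shuffles; the sign in the witness cancels the one in `†`.
    refine ⟨Chi.ofForm (((Equiv.Perm.sign σ : ℤ) • m) • (formBasis n k).coord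
      (ofFinEmbEquiv (OrderEmbedding.ofStrictMono _ hσ'.1))), ?_⟩
    rw [dagger_apply, Finset.sum_eq_single_of_mem σ hσ]
    · rw [Chi.ofForm_apply, LinearMap.smul_apply, coord_wedgeD_X hσ'.1 hσ'.1, if_pos rfl,
        smul_eq_mul, mul_one, hs]
      rcases Int.units_eq_one_or (Equiv.Perm.sign σ) with h1 | h1 <;>
        simp [h1, TensorProduct.neg_tmul]
    · intro τ hτ hne
      have hτ' := (mem_shuffles h τ).1 hτ
      have : (fun j => τ (blockEquiv h (.inl j))) ≠ fun j => σ (blockEquiv h (.inl j)) :=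
        fun he => hne (shuffle_ext_left h hτ hσ (by rw [he]))
      rw [Chi.ofForm_apply, LinearMap.smul_apply, coord_wedgeD_X hτ'.1 hσ'.1, if_neg this,
        smul_zero, TensorProduct.zero_tmul, smul_zero]
  rw [← LinearMap.range_eq_top, eq_top_iff]
  rintro x -
  induction x using TensorProduct.induction_on with
  | zero => exact zero_mem _
  | add x y hx hy => exact add_mem hx hy
  | tmul m y =>
    rw [← (formBasis n l).sum_repr y, TensorProduct.tmul_sum]
    refine sum_mem fun s _ => ?_
    rw [TensorProduct.tmul_smul, TensorProduct.smul_tmul']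
    exact key _ s

/-- There are no multiderivations with more arguments than variables. -/
lemma subsingleton_chi {k : ℕ} (hk : n < k) : Subsingleton (Chi (Poly n) k) := by
  refine subsingleton_of_forall_eq 0 fun P => Chi.eq_zero P fun v hv => ?_
  have := Fintype.card_le_of_injective v hv.injective
  simp only [Fintype.card_fin] at this
  omega

lemma subsingleton_chains {k : ℕ} (hk : n < k) :
    Subsingleton (Chains (Poly n) (Poly n) k) := by
  have : IsEmpty (Set.powersetCard (Fin n) k) := ⟨fun s => by
    have h1 := Finset.card_le_univ s.1
    rw [Set.powersetCard.card_eq s, Fintype.card_fin] at h1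
    omega⟩
  have : Subsingleton (⋀[Poly n]^k (Ω[Poly n⁄ℂ])) :=
    (formBasis n k).repr.toEquiv.subsingleton
  refine subsingleton_of_forall_eq 0 fun x => ?_
  induction x using TensorProduct.induction_on with
  | zero => rfl
  | add x y hx hy => rw [hx, hy, add_zero]
  | tmul m y => rw [Subsingleton.elim y 0, TensorProduct.tmul_zero]

end Bijective

/-! ### Passage to homology. -/

section Homology

/-- Quotienting by `B ∩ Z` avoids assuming `B ≤ Z`, so `∂ ∘ ∂ = 0` and `δ ∘ δ = 0` play no role in
the comparison. -/
lemma nonempty_subquotient_equiv {V W : Type*} [AddCommGroup V] [Module ℂ V] [AddCommGroup W]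
    [Module ℂ W] (e : V ≃ₗ[ℂ] W) {Z B : Submodule ℂ V} {Z' B' : Submodule ℂ W}
    (hZ : ∀ x, x ∈ Z ↔ e x ∈ Z') (hB : ∀ x, x ∈ B ↔ e x ∈ B') :
    Nonempty ((Z ⧸ B.comap Z.subtype) ≃ₗ[ℂ] (Z' ⧸ B'.comap Z'.subtype)) := by
  have hmap : Z.map (e : V →ₗ[ℂ] W) = Z' := by
    ext y
    obtain ⟨x, rfl⟩ := e.surjective y
    simp [hZ]
  refine ⟨Submodule.Quotient.equiv _ _ (e.ofSubmodules Z Z' hmap) ?_⟩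
  ext y
  obtain ⟨x, rfl⟩ := (e.ofSubmodules Z Z' hmap).surjective y
  simp [hB]

variable {n : ℕ}

lemma homology_equiv {A : Matrix (Fin n) (Fin n) ℤ} (hA : A.transpose = -A) {k l : ℕ}
    (h : k + l = n) :
    Nonempty (PoissonHomology (twistModule A hA) l ≃ₗ[ℂ]
      PoissonCohomology (quadBracket A hA) k) := by
  have hz : ∀ (j : ℕ) (x : Chains (Poly n) (Poly n) j) (i : ℕ),
      (-1 : ℤ) ^ i • x = 0 ↔ x = 0 := fun j x i => by
    rcases neg_one_pow_eq_or ℤ i with h | h <;> simp [h]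
  let e := LinearEquiv.ofBijective (dagger h) ⟨dagger_injective h, dagger_surjective h⟩
  have he : ∀ P, e P = dagger h P := fun _ => rfl
  refine (nonempty_subquotient_equiv e (Z := LinearMap.ker (coboundary (quadBracket A hA) k))
    (B := coboundaries (quadBracket A hA) k) (Z' := cycles (twistModule A hA) l)
    (B' := LinearMap.range (boundary (twistModule A hA) l)) ?_ ?_).map LinearEquiv.symm
  · intro P
    cases l with
    | zero =>
      -- Here `k = n`: every `0`-chain is a cycle, and every `n`-derivation is a cocycle since
      -- `χ^{n+1}` is zero.
      have := subsingleton_chi (n := n) (k := k + 1) (by omega)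
      exact ⟨fun _ => Submodule.mem_top, fun _ => Subsingleton.elim _ _⟩
    | succ l =>
      have h' : (k + 1) + l = n := by omega
      rw [LinearMap.mem_ker, ← map_eq_zero_iff _ (dagger_injective h'), dagger_coboundary hA h h',
        hz, he]
      rfl
  · intro P
    cases k with
    | zero =>
      -- Here `l = n`: there are no nonzero coboundaries in degree `0`, and no nonzero boundaries
      -- since the chains of degree `n + 1` vanish.
      have := subsingleton_chains (n := n) (k := l + 1) (by omega)
      change P ∈ (⊥ : Submodule ℂ _) ↔ _
      rw [Submodule.mem_bot, ← map_eq_zero_iff e e.injective]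
      constructor
      · intro h0; rw [h0]; exact zero_mem _
      · rintro ⟨y, hy⟩
        rw [← hy, Subsingleton.elim y 0, map_zero]
    | succ k =>
      have h' : k + (l + 1) = n := by omega
      constructor
      · rintro ⟨Q, rfl⟩
        rw [he, dagger_coboundary hA h' h]
        exact zsmul_mem (LinearMap.mem_range_self _ _) _
      · rintro ⟨y, hy⟩
        obtain ⟨Q, rfl⟩ := dagger_surjective h' y
        -- The sign compensates the one in `dagger_coboundary`.
        refine ⟨(-1 : ℤ) ^ (k + 1) • Q, dagger_injective h ?_⟩
        rw [map_zsmul, map_zsmul, dagger_coboundary hA h' h, neg_one_pow_smul_smul, hy, he]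

end Homology

end PoissonDuality

end

theorem mainTheorem1 (n : ℕ) (A : Matrix (Fin n) (Fin n) ℤ) (hA : A.transpose = -A) :
    (∀ k ≤ n, Nonempty (PoissonDuality.PoissonHomology (PoissonDuality.twistModule A hA) k ≃ₗ[ℂ]
      PoissonDuality.PoissonCohomology (PoissonDuality.quadBracket A hA) (n - k))) ∧
    (∀ k > n, Subsingleton
      (PoissonDuality.PoissonHomology (PoissonDuality.twistModule A hA) k)) ∧
    (∀ (k l : ℕ) (h : k + l = n), Function.Bijective (PoissonDuality.dagger h)) ∧
    (∀ (k l : ℕ) (h : k + (l + 1) = n) (P : PoissonDuality.Chi (PoissonDuality.Poly n) k),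
      PoissonDuality.dagger ((Nat.succ_add_eq_add_succ k l).trans h)
          (PoissonDuality.coboundary (PoissonDuality.quadBracket A hA) k P) =
        (-1 : ℤ) ^ (k + 1) • PoissonDuality.boundary (PoissonDuality.twistModule A hA) l
          (PoissonDuality.dagger h P)) := by
  refine ⟨fun k hk => PoissonDuality.homology_equiv hA (Nat.sub_add_cancel hk), fun k hk => ?_,
    fun k l h => ⟨PoissonDuality.dagger_injective h, PoissonDuality.dagger_surjective h⟩,
    fun k l h P => PoissonDuality.dagger_coboundary hA h _ P⟩
  have := PoissonDuality.subsingleton_chains hk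
  infer_instance
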